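/- Let $d,n\ge 1$ be integers, $p>0$ and $T>0$ real numbers, $\beta\in C_c^\infty(\mathbb R^d)$ real-valued, $a_0\in\mathcal S(\mathbb R^d)$ (complex-valued), and let $G$ be a real function on $[0,\infty)$ with $G(r)=\sum_{k\ge1}\frac{g_k}{k!}r^k$ (convergent) for $0\le r<R$, for some $R>0$ and real $g_k$. For $\varepsilon>0$ and $\xi\in\mathbb R^d$ with $|\xi|=1$ put $$a(t,x)=a_0(x+\varepsilon^{1-2n}t\xi)\exp\Big(-i\varepsilon^{-2n}G\big(\varepsilon^{2p}|a_0(x+\varepsilon^{1-2n}t\xi)|^2\big)\int_0^t\beta\big(\varepsilon^{-1}x+\varepsilon^{-2n}(t-s)\xi-T\xi\big)\,ds\Big),$$ $$\Phi(t,x)=x\cdot\xi+\tfrac{t}{2n},\qquad v(t,x)=\varepsilon^p\,a\big(\varepsilon^{2n}(t+T),\varepsilon(x+T\xi)\big)\,e^{i\Phi(t,x)}.$$ Write $\partial^\alpha=\partial_{x_1}^{\alpha_1}\cdots\partial_{x_d}^{\alpha_d}$, $D_x^j=\sum_{|\alpha|=j}\partial^\alpha$, $\widehat u(y)=(2\pi)^{-d/2}\int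 e^{-ix\cdot y}u(x)\,dx$, $\|u\|_{\mathcal FL^1}=\|\widehat u\|_{L^1}$ and $\|u\|_{H^s}=\|(1+|y|^2)^{s/2}\widehat u\|_{L^2}$. There are coefficients $c_\alpha(\xi)\in\mathbb C$ depending only on $d,n,\xi$ and $\alpha$, bounded uniformly over $|\xi|=1$ and $\alpha$ by a constant depending only on $d,n$, and there is $\varepsilon_0>0$ depending only on $d,n,p,T,\beta,G,a_0$, such that for all $0<\varepsilon<\varepsilon_0$ and all $|\xi|=1$ the function $a$ is $C^\infty$ on $\mathbb R\times\mathbb R^d$, all $\partial^\alpha a(t,\cdot)$ are integrable, and the following hold. 1. For all $x$, $v(-T,x)=\varepsilon^p a_0(\varepsilon(x+T\xi))\,e^{i(x\cdot\xi-\frac{T}{2n})}$. 2. For all $(t,x)\in\mathbb R\times\mathbb R^d$, with $a$ and its derivatives on the right evaluated at $(\varepsilon^{2n}(t+T),\varepsilon(x+T\xi))$, $$\Big(i\partial_t+\tfrac1{2n}(-\Delta)^n\Big)v-\beta(x)G(|v|^2)v=\varepsilon^{p+2n}e^{i\Phi}\Big[i\partial_ta-i\varepsilon^{1-2n}\xi\cdot\nabla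 a-\varepsilon^{-2n}\beta(x)G(\varepsilon^{2p}|a|^2)a\Big]+\varepsilon^{p+2n}e^{i\Phi}\sum_{j=2}^{2n}\varepsilon^{j-2n}\sum_{|\alpha|=j}c_\alpha(\xi)\,\partial^\alpha a .$$ Moreover the first bracket vanishes: $a(0,x)=a_0(x)$ and $i\partial_ta-i\varepsilon^{1-2n}\xi\cdot\nabla a-\varepsilon^{-2n}\beta(\varepsilon^{-1}x-T\xi)G(\varepsilon^{2p}|a|^2)a=0$ for all $(t,x)\in\mathbb R\times\mathbb R^d$. 3. For every $\sigma>0$ and every integer $j\ge0$ there is a constant $C$, independent of $\varepsilon\in(0,\varepsilon_0)$, $\xi$ and $t\in\mathbb R$, such that for all $t\in\mathbb R$ $$\|a(t)\|_{\mathcal FL^1}\le C\|a(t)\|_{H^{d/2+\sigma}},\qquad \|a(t)\|_{H^{d/2+\sigma}}\le C\max\{1,\varepsilon^{2p-2n-\sigma}\},$$ $$\|\partial^\alpha a(t)\|_{\mathcal FL^1}\le C\max\{1,\varepsilon^{2p-2n-j-\sigma}\}\ \ (|\alpha|=j),\qquad \|D_x^ja(t)\|_{\mathcal FL^1}\le C\max\{1,\varepsilon^{2p-2n-j-\sigma}\}.$$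 -/

import Mathlib

open MeasureTheory
open scoped ContDiff ENNReal SchwartzMap

noncomputable section

namespace WavePacket

/-- Euclidean space `ℝ^d`. -/
abbrev Sp (d : ℕ) : Type := EuclideanSpace ℝ (Fin d)

/-- The Fourier transform `(2π)^{-d/2} ∫ e^{-i x·y} u(x) dx`. -/
def fourierT {d : ℕ} (u : Sp d → ℂ) (y : Sp d) : ℂ :=
  (((2 * Real.pi) ^ (-((d : ℝ) / 2)) : ℝ) : ℂ) *
    ∫ x : Sp d, Complex.exp (-Complex.I * ((inner ℝ x y : ℝ) : ℂ)) * u x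

/-- The Fourier-Lebesgue norm: the `L^1` norm of the Fourier transform. -/
def normFL1 {d : ℕ} (u : Sp d → ℂ) : ℝ≥0∞ :=
  ∫⁻ y : Sp d, ‖fourierT u y‖ₑ

/-- The Sobolev norm `H^s`: the `L^2` norm of `(1 + |y|^2)^{s/2}` times the Fourier transform. -/
def normH {d : ℕ} (s : ℝ) (u : Sp d → ℂ) : ℝ≥0∞ :=
  (∫⁻ y : Sp d, ENNReal.ofReal ((1 + ‖y‖ ^ 2) ^ s) * ‖fourierT u y‖ₑ ^ 2) ^ (1 / 2 : ℝ)

/-- The partial derivative `∂_{x_i} f`. -/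
def pderiv {d : ℕ} (i : Fin d) (f : Sp d → ℂ) : Sp d → ℂ :=
  fun x => fderiv ℝ f x (EuclideanSpace.single i 1)

/-- The partial derivative `∂_{x_1}^{α_1} ⋯ ∂_{x_d}^{α_d} f` with multi-index `α`. -/
def mderiv {d : ℕ} (α : Fin d → ℕ) (f : Sp d → ℂ) : Sp d → ℂ :=
  (List.finRange d).foldr (fun i g => (pderiv i)^[α i] g) f

/-- The multi-indices `α` with `α_1 + ⋯ + α_d = j`. -/
def multiIndices (d j : ℕ) : Finset (Fin d → ℕ) :=
  Finset.piAntidiag Finset.univ j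

/-- `D_x^j f`, the sum of all partial derivatives of `f` of order `j`. -/
def Dx {d : ℕ} (j : ℕ) (f : Sp d → ℂ) : Sp d → ℂ :=
  fun x => ∑ α ∈ multiIndices d j, mderiv α f x

/-- The operator `(-Δ)^n`. -/
def negLaplacianPow {d : ℕ} (n : ℕ) (f : Sp d → ℂ) : Sp d → ℂ :=
  (fun g : Sp d → ℂ => -(Laplacian.laplacian g))^[n] f

/-- `(i ∂_t + (1/2n) (-Δ)^n) w - β G(|w|^2) w` at the point `(t, x)`. -/
def residual {d : ℕ} (n : ℕ) (β : Sp d → ℝ) (G : ℝ → ℝ) (w : ℝ → Sp d → ℂ)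
    (t : ℝ) (x : Sp d) : ℂ :=
  Complex.I * deriv (fun s => w s x) t + 1 / (2 * (n : ℂ)) * negLaplacianPow n (w t) x
    - (β x : ℂ) * (G (‖w t x‖ ^ 2) : ℂ) * w t x

/-- The amplitude `a(t, x)`. -/
def amplitude {d : ℕ} (n : ℕ) (p T : ℝ) (β : Sp d → ℝ) (G : ℝ → ℝ) (a₀ : Sp d → ℂ)
    (ε : ℝ) (ξ : Sp d) (t : ℝ) (x : Sp d) : ℂ :=
  a₀ (x + (ε ^ (1 - 2 * (n : ℝ)) * t) • ξ) *
    Complex.exp (-Complex.I *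
      ((ε ^ (-(2 * (n : ℝ))) *
        G (ε ^ (2 * p) * ‖a₀ (x + (ε ^ (1 - 2 * (n : ℝ)) * t) • ξ)‖ ^ 2) *
        ∫ s in (0 : ℝ)..t, β (ε⁻¹ • x + (ε ^ (-(2 * (n : ℝ))) * (t - s)) • ξ - T • ξ) : ℝ) : ℂ))

/-- The oscillating factor `e^{iΦ}`, with `Φ(t, x) = x·ξ + t/(2n)`. -/
def planeWave {d : ℕ} (n : ℕ) (ξ : Sp d) (t : ℝ) (x : Sp d) : ℂ :=
  Complex.exp (Complex.I * ((inner ℝ x ξ + t / (2 * (n : ℝ)) : ℝ) : ℂ))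

/-- The wave packet `v(t, x) = ε^p a(ε^{2n}(t + T), ε(x + Tξ)) e^{iΦ(t, x)}` of amplitude `a`. -/
def packet {d : ℕ} (n : ℕ) (p T ε : ℝ) (ξ : Sp d) (a : ℝ → Sp d → ℂ)
    (t : ℝ) (x : Sp d) : ℂ :=
  ((ε ^ p : ℝ) : ℂ) * a (ε ^ (2 * (n : ℝ)) * (t + T)) (ε • (x + T • ξ)) * planeWave n ξ t x

/-- `i ∂_t a - i ε^{1-2n} ξ·∇a - ε^{-2n} b G(ε^{2p} |a|^2) a` at the point `(t, x)`; here `b` is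
the value of the coefficient `β` at the corresponding point. -/
def transportTerm {d : ℕ} (n : ℕ) (p ε : ℝ) (ξ : Sp d) (G : ℝ → ℝ) (a : ℝ → Sp d → ℂ)
    (b t : ℝ) (x : Sp d) : ℂ :=
  Complex.I * deriv (fun s => a s x) t
    - Complex.I * ((ε ^ (1 - 2 * (n : ℝ)) : ℝ) : ℂ) * ∑ i, (ξ i : ℂ) * pderiv i (a t) x
    - ((ε ^ (-(2 * (n : ℝ))) * b * G (ε ^ (2 * p) * ‖a t x‖ ^ 2) : ℝ) : ℂ) * a t x

end WavePacket

end

/-! Algebra. Conjugating -Δ by the plane wave with |ξ| = 1 gives the operator with symbol |ξ - iX|²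
= 1 - 2iξ·X - X·X. Its n-th power has constant term 1, linear part -2in ξ·X and degree at most 2n.
After division by 2n, the constant term cancels the time derivative of the plane wave. The linear
part is the transport operator, and the degrees 2 to 2n are the error terms. Working with
polynomials (`applySymbol`, `conjSymbol`) turns iteration of -Δ into taking a power, so the
coefficients and their bounds can be read off (`negLaplacianPow_packet`, `residual_packet`). The
transport equation holds because moving along a characteristic changes a only by an explicit phase
(`transportTerm_amplitude`).

Estimates. Put z = x + ε^{1-2n}tξ, y = z/ε, ρ = ε^{2p}. Below a threshold for ε, the argument of G
stays in the range where G(r) = rH(r) with H smooth and compactly supported. The phase is then ρ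
h(y), where h contains the integral of β over a segment in direction ξ, of length proportional to
|t|. This integral is a difference of two values of one primitive of β along ξ. Since β has compact
support, all derivatives of that primitive are bounded, uniformly in the segment; hence the
uniformity in t. Thus a = a₀ + ρ a₀ Q(z/ε), where all derivatives of Q = (e^{-iρh} - 1)/ρ are
bounded uniformly in ε, ξ, t (`unifSmooth_corrector`).

Each derivative of the correction costs at most ε⁻¹, and the correction lives in a tube of radius
O(ε) around ℝξ, of weighted volume O(ε^{d-1}). Hence the k-th derivatives of a are bounded in L² by
1 + ε^{2p-k+(d-1)/2}, up to a constant (`exists_lintegral_profile_le`), and Plancherel gives the H^k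
norms for integer k. Monotonicity in the order and the embedding of H^s in FL¹ for s > d/2 finish
the proof: rounding up to an integer order loses at most 3/2 + σ in the exponent, which 2n + σ
covers because n ≥ 1. -/

noncomputable section

namespace WavePacket

/-! ### Iterated partial derivatives and multi-indices. -/

section PartialDerivatives

variable {d : ℕ}

lemma contDiff_pderiv {f : Sp d → ℂ} (hf : ContDiff ℝ ∞ f) (i : Fin d) :
    ContDiff ℝ ∞ (pderiv i f) :=
  (hf.fderiv_right (m := ∞) (by simp)).clm_apply contDiff_const

lemma contDiff_iterate_pderiv {f : Sp d → ℂ} (hf : ContDiff ℝ ∞ f) (i : Fin d) (k : ℕ) :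
    ContDiff ℝ ∞ ((pderiv i)^[k] f) := by
  induction k with
  | zero => simpa
  | succ k ih => rw [Function.iterate_succ_apply']; exact contDiff_pderiv ih i

lemma pderiv_pderiv_apply {f : Sp d → ℂ} (hf : ContDiff ℝ ∞ f) (i j : Fin d) (x : Sp d) :
    pderiv i (pderiv j f) x =
      fderiv ℝ (fderiv ℝ f) x (EuclideanSpace.single i 1) (EuclideanSpace.single j 1) := by
  have h : DifferentiableAt ℝ (fderiv ℝ f) x :=
    (hf.fderiv_right (m := ∞) (by simp)).differentiable (by simp) x
  unfold pderiv
  rw [fderiv_clm_apply h (differentiableAt_const _)]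
  simp

lemma pderiv_comm {f : Sp d → ℂ} (hf : ContDiff ℝ ∞ f) (i j : Fin d) :
    pderiv i (pderiv j f) = pderiv j (pderiv i f) := by
  ext x
  rw [pderiv_pderiv_apply hf, pderiv_pderiv_apply hf]
  exact (hf.contDiffAt.isSymmSndFDerivAt (by
    rw [minSmoothness_of_isRCLikeNormedField]; exact WithTop.coe_le_coe.2 (le_top : (2 : ℕ∞) ≤ ⊤))) _ _

lemma pderiv_iterate_comm {f : Sp d → ℂ} (hf : ContDiff ℝ ∞ f) (i j : Fin d) (k : ℕ) :
    (pderiv j)^[k] (pderiv i f) = pderiv i ((pderiv j)^[k] f) := by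
  induction k with
  | zero => rfl
  | succ k ih =>
    rw [Function.iterate_succ_apply', Function.iterate_succ_apply', ih,
      pderiv_comm (contDiff_iterate_pderiv hf j k)]

lemma contDiff_foldr_pderiv {f : Sp d → ℂ} (hf : ContDiff ℝ ∞ f) (α : Fin d → ℕ)
    (l : List (Fin d)) :
    ContDiff ℝ ∞ (l.foldr (fun i g => (pderiv i)^[α i] g) f) := by
  induction l with
  | nil => simpa
  | cons k l ih => exact contDiff_iterate_pderiv ih k _

lemma contDiff_mderiv {f : Sp d → ℂ} (hf : ContDiff ℝ ∞ f) (α : Fin d → ℕ) :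
    ContDiff ℝ ∞ (mderiv α f) :=
  contDiff_foldr_pderiv hf α _

lemma mderiv_zero (f : Sp d → ℂ) : mderiv 0 f = f := by
  unfold mderiv
  induction List.finRange d with
  | nil => rfl
  | cons k l ih => simp

lemma foldr_pderiv_add_single_of_notMem (f : Sp d → ℂ) (α : Fin d → ℕ) (i : Fin d)
    (l : List (Fin d)) (hi : i ∉ l) :
    l.foldr (fun j g => (pderiv j)^[(α + Pi.single i 1 : Fin d → ℕ) j] g) f =
      l.foldr (fun j g => (pderiv j)^[α j] g) f := by
  induction l with
  | nil => rfl
  | cons k l ih =>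
    simp only [List.mem_cons, not_or] at hi
    simp only [List.foldr_cons, ih hi.2]
    simp [Ne.symm hi.1]

/-- In a list without repetition only one factor sees the increment. The extra derivative is then
commuted to the front past the factors before it, which is where smoothness enters. -/
lemma foldr_pderiv_add_single {f : Sp d → ℂ} (hf : ContDiff ℝ ∞ f) (α : Fin d → ℕ) (i : Fin d)
    (l : List (Fin d)) (hi : i ∈ l) (hl : l.Nodup) :
    l.foldr (fun j g => (pderiv j)^[(α + Pi.single i 1 : Fin d → ℕ) j] g) f =
      pderiv i (l.foldr (fun j g => (pderiv j)^[α j] g) f) := by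
  induction l with
  | nil => simp at hi
  | cons k l ih =>
    rw [List.nodup_cons] at hl
    by_cases hk : k = i
    · subst hk
      rw [List.foldr_cons, List.foldr_cons, foldr_pderiv_add_single_of_notMem f α k l hl.1,
        Pi.add_apply, Pi.single_eq_same, Function.iterate_succ_apply']
    · have hil : i ∈ l := by
        rcases List.mem_cons.1 hi with h | h
        · exact absurd h.symm hk
        · exact h
      simp only [List.foldr_cons, ih hil hl.2]
      simp only [Pi.add_apply, Pi.single_apply, hk, if_false, add_zero]
      exact pderiv_iterate_comm (contDiff_foldr_pderiv hf α l) i k _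

lemma mderiv_add_single {f : Sp d → ℂ} (hf : ContDiff ℝ ∞ f) (α : Fin d → ℕ) (i : Fin d) :
    mderiv (α + Pi.single i 1) f = pderiv i (mderiv α f) :=
  foldr_pderiv_add_single hf α i _ (List.mem_finRange i) (List.nodup_finRange d)

lemma mderiv_single {f : Sp d → ℂ} (hf : ContDiff ℝ ∞ f) (i : Fin d) :
    mderiv (Pi.single i 1) f = pderiv i f := by
  have := mderiv_add_single hf 0 i
  rwa [zero_add, mderiv_zero] at this

/-- An induction principle for iterated partial derivatives of a smooth function. -/
lemma mderiv_induction {f : Sp d → ℂ} (hf : ContDiff ℝ ∞ f) (Q : ℕ → (Sp d → ℂ) → Prop)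
    (h0 : Q 0 f) (hs : ∀ k g i, Q k g → Q (k + 1) (pderiv i g)) (α : Fin d → ℕ) :
    Q (∑ i, α i) (mderiv α f) := by
  induction h : ∑ i, α i generalizing α with
  | zero =>
    have : α = 0 := by
      ext i
      exact (Finset.sum_eq_zero_iff.1 h) i (Finset.mem_univ i)
    rw [this, mderiv_zero]
    exact h0
  | succ m ih =>
    obtain ⟨i, -, hi⟩ := Finset.exists_ne_zero_of_sum_ne_zero (h.trans_ne m.succ_ne_zero)
    -- The truncated subtraction is exact because α i ≠ 0.
    have hα : (α - Pi.single i 1) + Pi.single i 1 = α := by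
      ext j
      by_cases hj : j = i
      · subst hj; simp; omega
      · simp [hj]
    have hsum : ∑ j, (α - Pi.single i 1 : Fin d → ℕ) j = m := by
      have h1 : ∑ j, ((α - Pi.single i 1 : Fin d → ℕ) j + (Pi.single i 1 : Fin d → ℕ) j)
          = m + 1 := by
        rw [← h]
        exact Finset.sum_congr rfl fun j _ => congrFun hα j
      rw [Finset.sum_add_distrib] at h1
      simp at h1
      simpa using h1
    rw [← hα, mderiv_add_single hf]
    exact hs _ _ _ (ih _ hsum)

lemma pderiv_comp_smul_add (c : ℂ) (ε : ℝ) (b : Sp d) (f : Sp d → ℂ)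
    (hf : Differentiable ℝ f) (i : Fin d) :
    pderiv i (fun x => c * f (ε • (x + b))) = fun x => (c * ε) * pderiv i f (ε • (x + b)) := by
  ext x
  have h1 : HasFDerivAt (fun x : Sp d => ε • (x + b)) (ε • ContinuousLinearMap.id ℝ (Sp d)) x :=
    ((hasFDerivAt_id x).add_const b).const_smul ε
  have h2 := ((hf (ε • (x + b))).hasFDerivAt.comp x h1).const_mul c
  have h3 : HasFDerivAt (fun x => c * f (ε • (x + b))) _ x := h2
  unfold pderiv
  rw [h3.fderiv]
  simp [mul_assoc]

lemma mderiv_comp_smul_add (c : ℂ) (ε : ℝ) (b : Sp d) {f : Sp d → ℂ}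
    (hf : ContDiff ℝ ∞ f) (α : Fin d → ℕ) :
    mderiv α (fun x => c * f (ε • (x + b))) =
      fun x => c * (ε : ℂ) ^ (∑ i, α i) * mderiv α f (ε • (x + b)) := by
  have key : ∀ l : List (Fin d), l.foldr (fun i g => (pderiv i)^[α i] g)
      (fun x => c * f (ε • (x + b))) = fun x => c * (ε : ℂ) ^ (l.map α).sum *
        l.foldr (fun i g => (pderiv i)^[α i] g) f (ε • (x + b)) := by
    intro l
    induction l with
    | nil => simp
    | cons k l ih =>
      simp only [List.foldr_cons, ih, List.map_cons, List.sum_cons]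
      have : ∀ m, (pderiv k)^[m] (fun x => c * (ε : ℂ) ^ (l.map α).sum *
          l.foldr (fun i g => (pderiv i)^[α i] g) f (ε • (x + b))) = fun x =>
          c * (ε : ℂ) ^ (m + (l.map α).sum) *
          (pderiv k)^[m] (l.foldr (fun i g => (pderiv i)^[α i] g) f) (ε • (x + b)) := by
        intro m
        induction m with
        | zero => simp
        | succ m ihm =>
          rw [Function.iterate_succ_apply', ihm, pderiv_comp_smul_add, Function.iterate_succ_apply']
          · ext x
            ring
          · exact (contDiff_iterate_pderiv (contDiff_foldr_pderiv hf α l) k m).differentiable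
              (by simp)
      exact this _
  have := key (List.finRange d)
  rw [Fin.sum_univ_def]
  exact this

end PartialDerivatives

/-! ### Constant-coefficient operators as polynomials, and conjugation of -Δ by a plane wave. -/

section Symbol

variable {d : ℕ}

/-- The differential operator with constant coefficients and symbol `q`, applied to `f`. -/
def applySymbol (f : Sp d → ℂ) : MvPolynomial (Fin d) ℂ →ₗ[ℂ] (Sp d → ℂ) :=
  (MvPolynomial.basisMonomials (Fin d) ℂ).constr ℂ fun α => mderiv α f

lemma applySymbol_monomial (f : Sp d → ℂ) (α : Fin d →₀ ℕ) (c : ℂ) :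
    applySymbol f (MvPolynomial.monomial α c) = c • mderiv α f := by
  have h : MvPolynomial.monomial α c = c • MvPolynomial.basisMonomials (Fin d) ℂ α := by
    simp [MvPolynomial.smul_monomial]
  rw [h, map_smul, applySymbol, Module.Basis.constr_basis]

lemma applySymbol_one (f : Sp d → ℂ) : applySymbol f 1 = f := by
  have := applySymbol_monomial f 0 1
  rw [one_smul, Finsupp.coe_zero, mderiv_zero] at this
  exact this

lemma contDiff_applySymbol {f : Sp d → ℂ} (hf : ContDiff ℝ ∞ f) (q : MvPolynomial (Fin d) ℂ) :
    ContDiff ℝ ∞ (applySymbol f q) := by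
  induction q using MvPolynomial.induction_on' with
  | monomial α c =>
    rw [applySymbol_monomial]
    exact contDiff_const.smul (contDiff_mderiv hf α)
  | add p q hp hq => rw [map_add]; exact hp.add hq

lemma pderiv_add {f g : Sp d → ℂ} (hf : Differentiable ℝ f) (hg : Differentiable ℝ g)
    (i : Fin d) : pderiv i (f + g) = pderiv i f + pderiv i g := by
  ext x
  simp [pderiv, fderiv_add (hf x) (hg x)]

lemma pderiv_const_smul (c : ℂ) {f : Sp d → ℂ} (hf : Differentiable ℝ f) (i : Fin d) :
    pderiv i (c • f) = c • pderiv i f := by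
  ext x
  have h := (hf x).hasFDerivAt.const_smul c
  unfold pderiv
  rw [h.fderiv]
  simp

/-- Makes composition with a derivative correspond to multiplication by a variable. `applySymbol` is
only defined as a linear map, so this has to be checked on monomials. -/
lemma applySymbol_X_mul {f : Sp d → ℂ} (hf : ContDiff ℝ ∞ f) (i : Fin d)
    (q : MvPolynomial (Fin d) ℂ) :
    applySymbol f (MvPolynomial.X i * q) = pderiv i (applySymbol f q) := by
  induction q using MvPolynomial.induction_on' with
  | monomial α c =>
    rw [mul_comm, MvPolynomial.X, MvPolynomial.monomial_mul, mul_one, applySymbol_monomial,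
      applySymbol_monomial, Finsupp.coe_add, Finsupp.single_eq_pi_single, mderiv_add_single hf]
    exact (pderiv_const_smul c ((contDiff_mderiv hf α).differentiable (by simp)) i).symm
  | add p q hp hq =>
    rw [mul_add, map_add, hp, hq, map_add, pderiv_add]
    · exact (contDiff_applySymbol hf p).differentiable (by simp)
    · exact (contDiff_applySymbol hf q).differentiable (by simp)

/-- The symbol `|ξ - iX|^2` of the conjugated operator `e^{-ix·ξ} (-Δ) e^{ix·ξ}`, `|ξ| = 1`. -/
def conjSymbol (ξ : Sp d) : MvPolynomial (Fin d) ℂ :=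
  1 + ∑ k, (MvPolynomial.C (-2 * Complex.I * ξ k) * MvPolynomial.X k
    - MvPolynomial.X k * MvPolynomial.X k)

/-- The right side has the shape produced by one application of -Δ in `neg_laplacian_planeWave_mul`,
so iterating -Δ multiplies by `conjSymbol ξ` each time. -/
lemma applySymbol_conjSymbol_mul {f : Sp d → ℂ} (hf : ContDiff ℝ ∞ f) (ξ : Sp d)
    (q : MvPolynomial (Fin d) ℂ) (x : Sp d) :
    applySymbol f (conjSymbol ξ * q) x = applySymbol f q x
      + ∑ k, (-2 * Complex.I * ξ k * pderiv k (applySymbol f q) x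
        - pderiv k (pderiv k (applySymbol f q)) x) := by
  rw [conjSymbol, add_mul, one_mul, map_add, Finset.sum_mul, map_sum, Pi.add_apply,
    Finset.sum_apply]
  congr 1
  refine Finset.sum_congr rfl fun k _ => ?_
  rw [sub_mul, map_sub, mul_assoc (MvPolynomial.C _), mul_assoc (MvPolynomial.X k),
    ← MvPolynomial.smul_eq_C_mul, map_smul, applySymbol_X_mul hf, applySymbol_X_mul hf,
    applySymbol_X_mul hf]
  simp

lemma laplacian_eq_sum_pderiv {f : Sp d → ℂ} (hf : ContDiff ℝ ∞ f) (x : Sp d) :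
    Laplacian.laplacian f x = ∑ k, pderiv k (pderiv k f) x := by
  rw [InnerProductSpace.laplacian_eq_iteratedFDeriv_orthonormalBasis f
    (EuclideanSpace.basisFun (Fin d) ℝ)]
  refine Finset.sum_congr rfl fun k _ => ?_
  rw [pderiv_pderiv_apply hf, iteratedFDeriv_two_apply]
  simp

lemma hasFDerivAt_planeWave (n : ℕ) (ξ : Sp d) (t : ℝ) (x : Sp d) :
    HasFDerivAt (planeWave n ξ t)
      ((planeWave n ξ t x * Complex.I) • (Complex.ofRealCLM.comp (innerSL ℝ ξ))) x := by
  have h1 : HasFDerivAt (fun x : Sp d => inner ℝ x ξ + t / (2 * (n : ℝ))) (innerSL ℝ ξ) x := by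
    have h0 := ((innerSL ℝ ξ).hasFDerivAt (x := x)).add_const (t / (2 * (n : ℝ)))
    refine h0.congr_of_eventuallyEq (Filter.Eventually.of_forall fun y => ?_)
    simp [real_inner_comm]
  have h2 := ((Complex.ofRealCLM.hasFDerivAt.comp x h1).const_mul Complex.I).cexp
  refine HasFDerivAt.congr_fderiv (f := planeWave n ξ t) h2 ?_
  ext v
  simp [planeWave, mul_assoc]

lemma contDiff_planeWave (n : ℕ) (ξ : Sp d) (t : ℝ) : ContDiff ℝ ∞ (planeWave n ξ t) := by
  unfold planeWave
  have : ContDiff ℝ ∞ (fun x : Sp d => ((inner ℝ x ξ + t / (2 * (n : ℝ)) : ℝ) : ℂ)) :=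
    Complex.ofRealCLM.contDiff.comp
      (contDiff_id.inner ℝ contDiff_const |>.add contDiff_const)
  fun_prop

lemma pderiv_planeWave_mul (n : ℕ) (ξ : Sp d) (t : ℝ) {h : Sp d → ℂ} (hh : Differentiable ℝ h)
    (k : Fin d) :
    pderiv k (fun x => planeWave n ξ t x * h x) =
      fun x => planeWave n ξ t x * (Complex.I * ξ k * h x + pderiv k h x) := by
  ext x
  have h1 : HasFDerivAt (fun x => planeWave n ξ t x * h x) _ x :=
    (hasFDerivAt_planeWave n ξ t x).mul (hh x).hasFDerivAt
  unfold pderiv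
  rw [h1.fderiv]
  simp [EuclideanSpace.inner_single_right]
  ring

lemma neg_laplacian_planeWave_mul (n : ℕ) {ξ : Sp d} (hξ : ‖ξ‖ = 1) (t : ℝ) {h : Sp d → ℂ}
    (hh : ContDiff ℝ ∞ h) (x : Sp d) :
    -Laplacian.laplacian (fun x => planeWave n ξ t x * h x) x =
      planeWave n ξ t x * (h x + ∑ k, (-2 * Complex.I * ξ k * pderiv k h x
        - pderiv k (pderiv k h) x)) := by
  rw [laplacian_eq_sum_pderiv ((contDiff_planeWave n ξ t).mul hh)]
  have h1 : ∀ k, pderiv k (pderiv k (fun x => planeWave n ξ t x * h x)) x =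
      planeWave n ξ t x * (-(ξ k : ℂ) ^ 2 * h x + 2 * Complex.I * ξ k * pderiv k h x
        + pderiv k (pderiv k h) x) := by
    intro k
    have hd : Differentiable ℝ h := hh.differentiable (by simp)
    have hd' : Differentiable ℝ (pderiv k h) := (contDiff_pderiv hh k).differentiable (by simp)
    rw [pderiv_planeWave_mul n ξ t hd, pderiv_planeWave_mul n ξ t
      (h := fun x => Complex.I * ξ k * h x + pderiv k h x) ((hd.const_mul _).add hd')]
    have h2 : pderiv k (fun x => Complex.I * ξ k * h x + pderiv k h x) x =
        Complex.I * ξ k * pderiv k h x + pderiv k (pderiv k h) x := by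
      have h3 : HasFDerivAt (fun x => Complex.I * ξ k * h x + pderiv k h x) _ x :=
        ((hd x).hasFDerivAt.const_mul (Complex.I * ξ k)).add (hd' x).hasFDerivAt
      rw [pderiv, h3.fderiv]
      simp [pderiv]
    simp only [h2]
    linear_combination (planeWave n ξ t x * (ξ k : ℂ) ^ 2 * h x) * Complex.I_sq
  have h3 : ∑ k, (ξ k : ℂ) ^ 2 = 1 := by
    have := EuclideanSpace.norm_sq_eq ξ
    rw [hξ] at this
    simp only [Real.norm_eq_abs, sq_abs, one_pow] at this
    exact_mod_cast this.symm
  simp only [h1]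
  rw [← Finset.mul_sum, ← mul_neg, ← Finset.sum_neg_distrib]
  congr 1
  -- Because |ξ| = 1, the undifferentiated term can be spread over the coordinates and the identity
  -- checked for each k separately.
  have h4 : h x = ∑ k, (ξ k : ℂ) ^ 2 * h x := by rw [← Finset.sum_mul, h3, one_mul]
  rw [h4, ← Finset.sum_add_distrib]
  refine Finset.sum_congr rfl fun k _ => ?_
  rw [← h4]
  ring

lemma negLaplacianPow_planeWave_mul (n m : ℕ) {ξ : Sp d} (hξ : ‖ξ‖ = 1) (t : ℝ) {h : Sp d → ℂ}
    (hh : ContDiff ℝ ∞ h) :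
    negLaplacianPow m (fun x => planeWave n ξ t x * h x) =
      fun x => planeWave n ξ t x * applySymbol h (conjSymbol ξ ^ m) x := by
  unfold negLaplacianPow
  induction m with
  | zero => simp [applySymbol_one]
  | succ m ih =>
    rw [Function.iterate_succ_apply', ih]
    ext x
    rw [pow_succ', applySymbol_conjSymbol_mul hh, Pi.neg_apply,
      neg_laplacian_planeWave_mul n hξ t (contDiff_applySymbol hh _)]

/-- Monomials are grouped by total degree; multi-indices outside the support are added at no cost,
their coefficients being zero. -/
lemma applySymbol_eq_sum (f : Sp d → ℂ) {q : MvPolynomial (Fin d) ℂ} {N : ℕ}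
    (hq : q.totalDegree ≤ N) (x : Sp d) :
    applySymbol f q x = ∑ j ∈ Finset.range (N + 1), ∑ α ∈ multiIndices d j,
      q.coeff (Finsupp.equivFunOnFinite.symm α) * mderiv α f x := by
  have h1 : applySymbol f q x = ∑ α ∈ q.support, q.coeff α * mderiv α f x := by
    conv_lhs => rw [q.as_sum]
    rw [map_sum, Finset.sum_apply]
    exact Finset.sum_congr rfl fun α _ => by rw [applySymbol_monomial]; rfl
  have hmaps : ∀ α ∈ q.support, ∑ i, α i ∈ Finset.range (N + 1) := by
    intro α hα
    have := (MvPolynomial.le_totalDegree hα).trans hq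
    rw [Finsupp.sum_fintype _ _ (by simp)] at this
    simpa [Nat.lt_succ_iff] using this
  rw [h1, ← Finset.sum_fiberwise_of_maps_to hmaps]
  refine Finset.sum_congr rfl fun j _ => ?_
  have h2 : ∑ α ∈ q.support with ∑ i, α i = j, q.coeff α * mderiv α f x =
      ∑ α ∈ (q.support.filter fun α => ∑ i, α i = j).map Finsupp.equivFunOnFinite.toEmbedding,
        q.coeff (Finsupp.equivFunOnFinite.symm α) * mderiv α f x := by
    rw [Finset.sum_map]
    refine Finset.sum_congr rfl fun α _ => ?_
    rw [Equiv.coe_toEmbedding, Equiv.symm_apply_apply]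
    rfl
  rw [h2]
  refine Finset.sum_subset ?_ ?_
  · intro α hα
    simp only [Finset.mem_map, Finset.mem_filter] at hα
    obtain ⟨γ, ⟨-, hγ⟩, rfl⟩ := hα
    simpa [multiIndices] using hγ
  · intro α hα hα'
    have : q.coeff (Finsupp.equivFunOnFinite.symm α) = 0 := by
      by_contra hne
      refine hα' (Finset.mem_map.2 ⟨Finsupp.equivFunOnFinite.symm α, ?_, by simp⟩)
      simp only [Finset.mem_filter, MvPolynomial.mem_support_iff]
      refine ⟨hne, ?_⟩
      simpa [multiIndices] using hα
    rw [this, zero_mul]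

lemma totalDegree_conjSymbol_le (ξ : Sp d) : (conjSymbol ξ).totalDegree ≤ 2 := by
  unfold conjSymbol
  refine (MvPolynomial.totalDegree_add _ _).trans (max_le (by simp) ?_)
  refine MvPolynomial.totalDegree_finsetSum_le fun k _ => ?_
  refine (MvPolynomial.totalDegree_sub _ _).trans (max_le ?_ ?_)
  · refine (MvPolynomial.totalDegree_mul _ _).trans ?_
    rw [MvPolynomial.totalDegree_C, MvPolynomial.totalDegree_X]
    norm_num
  · refine (MvPolynomial.totalDegree_mul _ _).trans ?_
    simp

lemma totalDegree_conjSymbol_pow_le (ξ : Sp d) (n : ℕ) :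
    (conjSymbol ξ ^ n).totalDegree ≤ 2 * n :=
  (MvPolynomial.totalDegree_pow _ _).trans
    ((Nat.mul_le_mul_left n (totalDegree_conjSymbol_le ξ)).trans_eq (mul_comm _ _))

lemma coeff_zero_conjSymbol_pow (ξ : Sp d) (n : ℕ) : (conjSymbol ξ ^ n).coeff 0 = 1 := by
  rw [← MvPolynomial.constantCoeff_eq, map_pow]
  simp [conjSymbol]

lemma coeff_single_conjSymbol (ξ : Sp d) (k : Fin d) :
    (conjSymbol ξ).coeff (Finsupp.single k 1) = -2 * Complex.I * ξ k := by
  unfold conjSymbol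
  rw [MvPolynomial.coeff_add, MvPolynomial.coeff_sum, Finset.sum_eq_single k]
  · rw [MvPolynomial.coeff_sub, MvPolynomial.coeff_C_mul, MvPolynomial.coeff_one,
      if_neg (Finsupp.single_ne_zero.2 one_ne_zero).symm]
    simp [MvPolynomial.coeff_X_mul']
  · intro b _ hb
    rw [MvPolynomial.coeff_sub, MvPolynomial.coeff_C_mul]
    simp [MvPolynomial.coeff_X_mul', hb]
  · simp

/-- An exponent of degree one splits in exactly two ways. -/
lemma coeff_single_mul (p q : MvPolynomial (Fin d) ℂ) (k : Fin d) :
    (p * q).coeff (Finsupp.single k 1) =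
      p.coeff 0 * q.coeff (Finsupp.single k 1) + p.coeff (Finsupp.single k 1) * q.coeff 0 := by
  rw [MvPolynomial.coeff_mul, Finsupp.antidiagonal_single, Finset.sum_map]
  have : Finset.HasAntidiagonal.antidiagonal 1 = ({(0, 1), (1, 0)} : Finset (ℕ × ℕ)) := rfl
  rw [this, Finset.sum_pair (by simp)]
  simp

lemma coeff_single_conjSymbol_pow (ξ : Sp d) (n : ℕ) (k : Fin d) :
    (conjSymbol ξ ^ n).coeff (Finsupp.single k 1) = n * (-2 * Complex.I * ξ k) := by
  induction n with
  | zero =>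
    rw [pow_zero, MvPolynomial.coeff_one, if_neg (Finsupp.single_ne_zero.2 one_ne_zero).symm]
    simp
  | succ n ih =>
    rw [pow_succ, coeff_single_mul, ih, coeff_zero_conjSymbol_pow, coeff_single_conjSymbol,
      ← pow_one (conjSymbol ξ), coeff_zero_conjSymbol_pow]
    push_cast
    ring

lemma norm_coeff_X_mul_le {q : MvPolynomial (Fin d) ℂ} {K : ℝ} (hK : ∀ α, ‖q.coeff α‖ ≤ K)
    (k : Fin d) (α : Fin d →₀ ℕ) : ‖(MvPolynomial.X k * q).coeff α‖ ≤ K := by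
  rw [MvPolynomial.coeff_X_mul']
  split_ifs
  · exact hK _
  · simpa using (norm_nonneg _).trans (hK α)

/-- Multiplication by a variable only shifts coefficients. One factor of the symbol therefore
enlarges their supremum by at most 1 + 3d: for each coordinate, 2|ξ_k| ≤ 2 from the linear term and
1 from the square. -/
lemma norm_coeff_conjSymbol_pow_le {ξ : Sp d} (hξ : ‖ξ‖ = 1) (n : ℕ) (α : Fin d →₀ ℕ) :
    ‖(conjSymbol ξ ^ n).coeff α‖ ≤ (1 + 3 * d) ^ n := by
  induction n generalizing α with
  | zero =>
    rw [pow_zero, pow_zero, MvPolynomial.coeff_one]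
    split_ifs <;> simp
  | succ n ih =>
    have hξk : ∀ k, ‖(ξ k : ℂ)‖ ≤ 1 := fun k => by
      simpa [hξ] using PiLp.norm_apply_le ξ k
    have hterm : ∀ k, ‖((MvPolynomial.C (-2 * Complex.I * ξ k) * MvPolynomial.X k
        - MvPolynomial.X k * MvPolynomial.X k) * conjSymbol ξ ^ n).coeff α‖
          ≤ 3 * (1 + 3 * (d : ℝ)) ^ n := by
      intro k
      rw [sub_mul, MvPolynomial.coeff_sub, mul_assoc (MvPolynomial.C _),
        mul_assoc (MvPolynomial.X k), MvPolynomial.coeff_C_mul]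
      refine (norm_sub_le _ _).trans ?_
      have h1 := norm_coeff_X_mul_le ih k α
      have h2 := norm_coeff_X_mul_le (fun γ => norm_coeff_X_mul_le ih k γ) k α
      have h3 : ‖(-2 * Complex.I * ξ k : ℂ)‖ ≤ 2 := by
        simpa using hξk k
      rw [norm_mul]
      have := mul_le_mul h3 h1 (norm_nonneg _) (by norm_num)
      linarith
    rw [pow_succ', conjSymbol, add_mul, one_mul, ← conjSymbol, MvPolynomial.coeff_add,
      Finset.sum_mul, MvPolynomial.coeff_sum]
    refine (norm_add_le _ _).trans ?_
    refine (add_le_add (ih α) ((norm_sum_le _ _).trans (Finset.sum_le_sum fun k _ => hterm k))).trans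
      ?_
    simp only [Finset.sum_const, Finset.card_univ, Fintype.card_fin, nsmul_eq_mul]
    rw [pow_succ]
    apply le_of_eq
    ring

/-- The coefficients of the error terms in the expansion of the residual. -/
def errorCoeff (n : ℕ) (ξ : Sp d) (α : Fin d → ℕ) : ℂ :=
  1 / (2 * (n : ℂ)) * (conjSymbol ξ ^ n).coeff (Finsupp.equivFunOnFinite.symm α)

lemma norm_errorCoeff_le (n : ℕ) {ξ : Sp d} (hξ : ‖ξ‖ = 1) (α : Fin d → ℕ) :
    ‖errorCoeff n ξ α‖ ≤ ‖1 / (2 * (n : ℂ))‖ * (1 + 3 * d) ^ n := by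
  rw [errorCoeff, norm_mul]
  gcongr
  exact norm_coeff_conjSymbol_pow_le hξ n _

lemma multiIndices_zero : multiIndices d 0 = {0} := by
  simp [multiIndices]

lemma sum_multiIndices_one {M : Type*} [AddCommMonoid M] (F : (Fin d → ℕ) → M) :
    ∑ α ∈ multiIndices d 1, F α = ∑ k, F (Pi.single k 1) := by
  have : multiIndices d 1 = Finset.univ.image fun k => (Pi.single k 1 : Fin d → ℕ) := by
    ext α
    simp only [multiIndices, Finset.mem_piAntidiag, Finset.mem_image, Finset.mem_univ, true_and]
    constructor
    · rintro ⟨h, -⟩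
      obtain ⟨i, -, hi⟩ := Finset.exists_ne_zero_of_sum_ne_zero (h.trans_ne one_ne_zero)
      refine ⟨i, ?_⟩
      have h1 := Finset.add_sum_erase Finset.univ α (Finset.mem_univ i)
      rw [h] at h1
      have h2 : ∑ x ∈ Finset.univ.erase i, α x = 0 := by omega
      ext j
      by_cases hj : j = i
      · subst hj; simp; omega
      · simp only [ne_eq, hj, not_false_eq_true, Pi.single_eq_of_ne]
        exact ((Finset.sum_eq_zero_iff.1 h2) j (by simp [hj])).symm
    · rintro ⟨k, rfl⟩
      simp
  rw [this, Finset.sum_image]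
  intro a _ b _ hab
  by_contra hne
  have := congrFun hab a
  simp [hne] at this

/-- The expansion of `(1/2n) (-Δ)^n` on a rescaled function times a plane wave. -/
lemma negLaplacianPow_packet (n : ℕ) (hn : 1 ≤ n) {ξ : Sp d} (hξ : ‖ξ‖ = 1) (t : ℝ)
    {f : Sp d → ℂ} (hf : ContDiff ℝ ∞ f) (A : ℂ) (ε : ℝ) (b x : Sp d) :
    1 / (2 * (n : ℂ)) *
      negLaplacianPow n (fun x => A * f (ε • (x + b)) * planeWave n ξ t x) x =
    A * planeWave n ξ t x * (1 / (2 * (n : ℂ)) * f (ε • (x + b))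
      - Complex.I * ε * ∑ k, (ξ k : ℂ) * pderiv k f (ε • (x + b))
      + ∑ j ∈ Finset.Icc 2 (2 * n), (ε : ℂ) ^ j * ∑ α ∈ multiIndices d j,
        errorCoeff n ξ α * mderiv α f (ε • (x + b))) := by
  have h1 : (fun x => A * f (ε • (x + b)) * planeWave n ξ t x) =
      fun x => planeWave n ξ t x * (A * f (ε • (x + b))) := by
    ext x
    ring
  have hg : ContDiff ℝ ∞ (fun x : Sp d => A * f (ε • (x + b))) := by fun_prop
  rw [h1, negLaplacianPow_planeWave_mul n n hξ t hg]
  beta_reduce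
  rw [applySymbol_eq_sum _ (totalDegree_conjSymbol_pow_le ξ n)]
  -- Degrees 0 and 1 give the phase and transport terms. Both lie in the range because n ≥ 1.
  have hsplit : Finset.range (2 * n + 1) = insert 0 (insert 1 (Finset.Icc 2 (2 * n))) := by
    ext j
    simp only [Finset.mem_range, Finset.mem_insert, Finset.mem_Icc]
    omega
  have hin : ∀ j, ∑ α ∈ multiIndices d j, (conjSymbol ξ ^ n).coeff
      (Finsupp.equivFunOnFinite.symm α) * mderiv α (fun x => A * f (ε • (x + b))) x =
      A * ((ε : ℂ) ^ j * ∑ α ∈ multiIndices d j, (conjSymbol ξ ^ n).coeff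
      (Finsupp.equivFunOnFinite.symm α) * mderiv α f (ε • (x + b))) := by
    intro j
    rw [Finset.mul_sum, Finset.mul_sum]
    refine Finset.sum_congr rfl fun α hα => ?_
    have hαj : ∑ i, α i = j := by
      simpa [multiIndices] using hα
    rw [mderiv_comp_smul_add A ε b hf, hαj]
    ring
  simp only [hin]
  rw [hsplit, Finset.sum_insert (by simp), Finset.sum_insert (by simp), multiIndices_zero,
    sum_multiIndices_one]
  have hs : ∀ k : Fin d, Finsupp.equivFunOnFinite.symm (Pi.single k 1) = Finsupp.single k 1 := by
    intro k
    rw [Equiv.symm_apply_eq]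
    ext i
    simp [Finsupp.single_apply, Pi.single_apply, eq_comm]
  have h0 : Finsupp.equivFunOnFinite.symm (0 : Fin d → ℕ) = 0 := by
    rw [Equiv.symm_apply_eq]
    rfl
  simp only [Finset.sum_singleton, hs, h0, coeff_zero_conjSymbol_pow, coeff_single_conjSymbol_pow,
    mderiv_zero, mderiv_single hf, pow_zero, pow_one]
  have hn0 : (n : ℂ) ≠ 0 := by exact_mod_cast (by omega : n ≠ 0)
  have h5 : ∑ k, (n : ℂ) * (-2 * Complex.I * ξ k) * pderiv k f (ε • (x + b)) =
      -2 * n * Complex.I * ∑ k, (ξ k : ℂ) * pderiv k f (ε • (x + b)) := by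
    rw [Finset.mul_sum]
    exact Finset.sum_congr rfl fun k _ => by ring
  have h6 : ∑ j ∈ Finset.Icc 2 (2 * n), (ε : ℂ) ^ j * ∑ α ∈ multiIndices d j,
        errorCoeff n ξ α * mderiv α f (ε • (x + b)) = 1 / (2 * (n : ℂ)) *
        ∑ j ∈ Finset.Icc 2 (2 * n), (ε : ℂ) ^ j * ∑ α ∈ multiIndices d j,
        (conjSymbol ξ ^ n).coeff (Finsupp.equivFunOnFinite.symm α) *
          mderiv α f (ε • (x + b)) := by
    rw [Finset.mul_sum]
    refine Finset.sum_congr rfl fun j _ => ?_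
    rw [mul_left_comm, Finset.mul_sum (s := multiIndices d j) (a := 1 / (2 * (n : ℂ)))]
    simp only [errorCoeff, mul_assoc]
  rw [h5, h6, ← Finset.mul_sum]
  field_simp
  ring

end Symbol

/-! ### Fourier transform of Schwartz functions, Plancherel, Sobolev and Fourier-Lebesgue norms. -/

section Fourier

open scoped FourierTransform LineDeriv

variable {d : ℕ}

/-- Mathlib's transform has 2π in the exponent; the two normalizations differ by a dilation of the
frequency and a constant. -/
lemma fourierT_eq (u : Sp d → ℂ) (y : Sp d) :
    fourierT u y = (((2 * Real.pi) ^ (-((d : ℝ) / 2)) : ℝ) : ℂ) * 𝓕 u ((2 * Real.pi)⁻¹ • y) := by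
  rw [fourierT, Real.fourier_eq']
  congr 2
  ext x
  rw [smul_eq_mul]
  congr 2
  rw [inner_smul_right]
  have : (Real.pi : ℂ) ≠ 0 := by exact_mod_cast Real.pi_ne_zero
  push_cast
  field_simp

lemma continuous_fourierT (F : 𝓢(Sp d, ℂ)) : Continuous (fourierT F) := by
  have h : fourierT F = fun y => (((2 * Real.pi) ^ (-((d : ℝ) / 2)) : ℝ) : ℂ) *
      (𝓕 F : 𝓢(Sp d, ℂ)) ((2 * Real.pi)⁻¹ • y) := by
    ext y
    rw [fourierT_eq, SchwartzMap.fourier_coe]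
  rw [h]
  exact continuous_const.mul ((𝓕 F : 𝓢(Sp d, ℂ)).continuous.comp (continuous_const_smul _))

/-- Plancherel's theorem for Schwartz functions, with the normalization of `fourierT`. -/
lemma lintegral_enorm_fourierT_sq (F : 𝓢(Sp d, ℂ)) :
    ∫⁻ y, ‖fourierT F y‖ₑ ^ 2 = ∫⁻ x, ‖F x‖ₑ ^ 2 := by
  have hsq : ∀ F : 𝓢(Sp d, ℂ), Integrable fun x => ‖F x‖ ^ 2 := fun F =>
    (F.memLp 2).integrable_norm_pow (by norm_num)
  have hp : (2 * Real.pi)⁻¹ ≠ 0 := by positivity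
  have hn : ∀ y, ‖fourierT F y‖ ^ 2 = (2 * Real.pi) ^ (-(d : ℝ)) *
      ‖(𝓕 F : 𝓢(Sp d, ℂ)) ((2 * Real.pi)⁻¹ • y)‖ ^ 2 := by
    intro y
    rw [fourierT_eq, norm_mul, mul_pow, SchwartzMap.fourier_coe, Complex.norm_real,
      Real.norm_of_nonneg (by positivity), ← Real.rpow_natCast, ← Real.rpow_mul (by positivity)]
    congr 2
    push_cast
    ring
  have hint : Integrable fun y => ‖fourierT F y‖ ^ 2 := by
    simp only [hn]
    exact ((hsq (𝓕 F)).comp_smul hp).const_mul _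
  have e : ∀ f : Sp d → ℂ, Integrable (fun y => ‖f y‖ ^ 2) →
      ∫⁻ y, ‖f y‖ₑ ^ 2 = ENNReal.ofReal (∫ y, ‖f y‖ ^ 2) := by
    intro f hf
    rw [ofReal_integral_eq_lintegral_ofReal hf (Filter.Eventually.of_forall fun _ => by positivity)]
    refine lintegral_congr fun y => ?_
    rw [ENNReal.ofReal_pow (norm_nonneg _), ofReal_norm]
  rw [e _ hint, e _ (hsq F)]
  congr 1
  simp only [hn]
  rw [integral_const_mul,
    Measure.integral_comp_smul volume (fun y => ‖(𝓕 F : 𝓢(Sp d, ℂ)) y‖ ^ 2) (2 * Real.pi)⁻¹,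
    SchwartzMap.integral_norm_sq_fourier, smul_eq_mul, ← mul_assoc]
  -- The normalizing constant squared cancels the Jacobian of the frequency dilation.
  have : (2 * Real.pi) ^ (-(d : ℝ)) * |(((2 * Real.pi)⁻¹) ^ Module.finrank ℝ (Sp d))⁻¹| = 1 := by
    rw [finrank_euclideanSpace_fin, inv_pow, inv_inv, abs_of_pos (by positivity),
      Real.rpow_neg (by positivity), Real.rpow_natCast]
    exact inv_mul_cancel₀ (by positivity)
  rw [this, one_mul]

lemma coe_lineDeriv_single (F : 𝓢(Sp d, ℂ)) (i : Fin d) :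
    ⇑(∂_{(EuclideanSpace.single i (1 : ℝ) : Sp d)} F : 𝓢(Sp d, ℂ)) = pderiv i F := rfl

lemma fourierT_pderiv (F : 𝓢(Sp d, ℂ)) (i : Fin d) (y : Sp d) :
    fourierT (pderiv i F) y = Complex.I * y i * fourierT F y := by
  rw [← coe_lineDeriv_single, fourierT_eq, fourierT_eq, ← SchwartzMap.fourier_coe,
    SchwartzMap.fourier_lineDerivOp_eq, ← SchwartzMap.fourier_coe]
  have h : (fun x : Sp d => inner ℝ x (EuclideanSpace.single i (1 : ℝ))).HasTemperateGrowth := by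
    fun_prop
  have : (Real.pi : ℂ) ≠ 0 := by exact_mod_cast Real.pi_ne_zero
  rw [smul_apply, SchwartzMap.smulLeftCLM_apply_apply h]
  simp [EuclideanSpace.inner_single_right]
  field_simp

lemma norm_fourierT_iterate_pderiv (F : 𝓢(Sp d, ℂ)) (i : Fin d) (k : ℕ) :
    ∃ H : 𝓢(Sp d, ℂ), ⇑H = (pderiv i)^[k] F ∧
      ∀ y, ‖fourierT H y‖ = |y i| ^ k * ‖fourierT F y‖ := by
  induction k with
  | zero => exact ⟨F, rfl, fun y => by simp⟩
  | succ k ih =>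
    obtain ⟨H, hH, hy⟩ := ih
    refine ⟨∂_{(EuclideanSpace.single i (1 : ℝ) : Sp d)} H, ?_, fun y => ?_⟩
    · rw [coe_lineDeriv_single, Function.iterate_succ_apply', hH]
    · rw [coe_lineDeriv_single, fourierT_pderiv, norm_mul, hy]
      simp
      ring

/-- The iterated partial derivatives of a Schwartz function are Schwartz functions, and their
Fourier transforms are bounded by powers of the frequency. -/
lemma exists_schwartz_mderiv (F : 𝓢(Sp d, ℂ)) (α : Fin d → ℕ) :
    ∃ H : 𝓢(Sp d, ℂ), ⇑H = mderiv α F ∧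
      ∀ y, ‖fourierT H y‖ ≤ ‖y‖ ^ (∑ i, α i) * ‖fourierT F y‖ := by
  refine mderiv_induction (F.smooth ⊤) (fun k g => ∃ H : 𝓢(Sp d, ℂ), ⇑H = g ∧
      ∀ y, ‖fourierT H y‖ ≤ ‖y‖ ^ k * ‖fourierT F y‖) ⟨F, rfl, by simp⟩ ?_ α
  rintro k g i ⟨H, rfl, hy⟩
  refine ⟨∂_{(EuclideanSpace.single i (1 : ℝ) : Sp d)} H, coe_lineDeriv_single H i, fun y => ?_⟩
  rw [coe_lineDeriv_single, fourierT_pderiv, norm_mul, norm_mul, Complex.norm_I, one_mul,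
    Complex.norm_real, pow_succ', mul_assoc]
  exact mul_le_mul (PiLp.norm_apply_le y i) (hy y) (norm_nonneg _) (norm_nonneg _)

lemma integrable_mderiv (F : 𝓢(Sp d, ℂ)) (α : Fin d → ℕ) : Integrable (mderiv α F) := by
  obtain ⟨H, hH, -⟩ := exists_schwartz_mderiv F α
  rw [← hH]
  exact H.integrable

lemma norm_iteratedFDeriv_iterate_pderiv_le {f : Sp d → ℂ} (hf : ContDiff ℝ ∞ f) (i : Fin d)
    (k m : ℕ) (x : Sp d) :
    ‖iteratedFDeriv ℝ m ((pderiv i)^[k] f) x‖ ≤ ‖iteratedFDeriv ℝ (m + k) f x‖ := by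
  induction k generalizing m with
  | zero => rfl
  | succ k ih =>
    rw [Function.iterate_succ_apply']
    have hg := contDiff_iterate_pderiv hf i k
    have h1 := norm_iteratedFDeriv_clm_apply_const (n := m) (N := ∞)
      (c := (EuclideanSpace.single i (1 : ℝ) : Sp d)) (x := x)
      (f := fderiv ℝ ((pderiv i)^[k] f))
      (hg.fderiv_right (m := ∞) (by simp)).contDiffAt (mod_cast le_top)
    refine h1.trans ?_
    rw [norm_iteratedFDeriv_fderiv, PiLp.norm_single, norm_one, one_mul]
    refine (ih (m + 1)).trans_eq ?_
    rw [show m + 1 + k = m + (k + 1) by ring]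

/-- The |y_i|^k are the moduli of the symbols of the pure derivatives ∂_i^k, so the Sobolev weight
is controlled without mixed derivatives. The power-mean inequality is stated for exponents k + 1,
hence the separate case k = 0. -/
lemma one_add_norm_sq_pow_le (k : ℕ) (y : Sp d) :
    (1 + ‖y‖ ^ 2) ^ k ≤ 2 ^ k * (1 + (d : ℝ) ^ k * ∑ i, (|y i| ^ k) ^ 2) := by
  rcases k with _ | k
  · simp
  have h1 : (‖y‖ ^ 2) ^ (k + 1) ≤ (d : ℝ) ^ k * ∑ i, (|y i| ^ (k + 1)) ^ 2 := by
    have h := pow_sum_le_card_mul_sum_pow (s := Finset.univ) (f := fun i => ‖y i‖ ^ 2)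
      (fun i _ => by positivity) k
    rw [EuclideanSpace.norm_sq_eq]
    simpa only [Finset.card_univ, Fintype.card_fin, pow_right_comm _ 2 (k + 1),
      Real.norm_eq_abs] using h
  have hd : (d : ℝ) ^ k * ∑ i, (|y i| ^ (k + 1)) ^ 2 ≤
      (d : ℝ) ^ (k + 1) * ∑ i, (|y i| ^ (k + 1)) ^ 2 := by
    rcases Nat.eq_zero_or_pos d with rfl | hd
    · simp
    · refine mul_le_mul_of_nonneg_right ?_ (Finset.sum_nonneg fun i _ => by positivity)
      exact pow_le_pow_right₀ (by exact_mod_cast hd) (Nat.le_succ k)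
  refine (add_pow_le zero_le_one (by positivity) (k + 1)).trans ?_
  rw [one_pow]
  refine mul_le_mul ?_ (by linarith) (by positivity) (by positivity)
  exact pow_le_pow_right₀ (by norm_num) (by simp)

/-- The `H^k` norm of a Schwartz function, `k` an integer, is controlled by the `L^2` norms of the
function and of its derivative of order `k`. -/
lemma normH_natCast_le (k : ℕ) (F : 𝓢(Sp d, ℂ)) :
    normH k F ≤ (ENNReal.ofReal (2 ^ k * (1 + (d : ℝ) ^ k * d)) *
      ((∫⁻ x, ‖F x‖ₑ ^ 2) + ∫⁻ x, ‖iteratedFDeriv ℝ k F x‖ₑ ^ 2)) ^ (1 / 2 : ℝ) := by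
  unfold normH
  refine ENNReal.rpow_le_rpow ?_ (by norm_num)
  have hmeas : Measurable fun y => ‖fourierT F y‖ₑ ^ 2 :=
    ((continuous_fourierT F).enorm.measurable).pow_const 2
  -- The integrand is the squared modulus of the transform of ∂_i^k F, so Plancherel applies.
  have hder : ∀ i, ∫⁻ y, ENNReal.ofReal ((|y i| ^ k) ^ 2) * ‖fourierT F y‖ₑ ^ 2 ≤
      ∫⁻ x, ‖iteratedFDeriv ℝ k F x‖ₑ ^ 2 := by
    intro i
    obtain ⟨H, hH, hy⟩ := norm_fourierT_iterate_pderiv F i k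
    have h1 : ∀ y, ENNReal.ofReal ((|y i| ^ k) ^ 2) * ‖fourierT F y‖ₑ ^ 2 = ‖fourierT H y‖ₑ ^ 2 := by
      intro y
      rw [← ofReal_norm, ← ofReal_norm, ← ENNReal.ofReal_pow (norm_nonneg _),
        ← ENNReal.ofReal_pow (norm_nonneg _), ← ENNReal.ofReal_mul (by positivity), hy, mul_pow]
    simp only [h1]
    rw [lintegral_enorm_fourierT_sq, hH]
    refine lintegral_mono fun x => ?_
    gcongr ?_ ^ 2
    have := norm_iteratedFDeriv_iterate_pderiv_le (F.smooth ⊤) i k 0 x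
    rw [norm_iteratedFDeriv_zero, zero_add] at this
    exact enorm_le_iff_norm_le.2 this
  set D := ∫⁻ x, ‖iteratedFDeriv ℝ k F x‖ₑ ^ 2 with hD
  calc ∫⁻ y, ENNReal.ofReal ((1 + ‖y‖ ^ 2) ^ (k : ℝ)) * ‖fourierT F y‖ₑ ^ 2
      ≤ ∫⁻ y, ENNReal.ofReal (2 ^ k) * (‖fourierT F y‖ₑ ^ 2 + ENNReal.ofReal ((d : ℝ) ^ k) *
          ∑ i, ENNReal.ofReal ((|y i| ^ k) ^ 2) * ‖fourierT F y‖ₑ ^ 2) := by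
        refine lintegral_mono fun y => ?_
        have h := ENNReal.ofReal_le_ofReal (one_add_norm_sq_pow_le k y)
        rw [Real.rpow_natCast]
        refine (mul_le_mul_left h _).trans_eq ?_
        rw [ENNReal.ofReal_mul (by positivity), ENNReal.ofReal_add (by norm_num) (by positivity),
          ENNReal.ofReal_mul (by positivity), ENNReal.ofReal_sum_of_nonneg (fun i _ => by positivity),
          ← Finset.sum_mul, ENNReal.ofReal_one]
        ring
    _ = ENNReal.ofReal (2 ^ k) * ((∫⁻ y, ‖fourierT F y‖ₑ ^ 2) + ENNReal.ofReal ((d : ℝ) ^ k) *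
          ∑ i, ∫⁻ y, ENNReal.ofReal ((|y i| ^ k) ^ 2) * ‖fourierT F y‖ₑ ^ 2) := by
        have hm : ∀ i : Fin d, Measurable fun y : Sp d =>
            ENNReal.ofReal ((|y i| ^ k) ^ 2) * ‖fourierT F y‖ₑ ^ 2 := fun i =>
          Measurable.mul (by fun_prop) hmeas
        rw [lintegral_const_mul' _ _ ENNReal.ofReal_ne_top, lintegral_add_left hmeas,
          lintegral_const_mul' _ _ ENNReal.ofReal_ne_top, lintegral_finsetSum _ fun i _ => hm i]
    _ ≤ ENNReal.ofReal (2 ^ k) * ((∫⁻ x, ‖F x‖ₑ ^ 2) + ENNReal.ofReal ((d : ℝ) ^ k) * (d * D)) := by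
        rw [lintegral_enorm_fourierT_sq]
        gcongr
        refine (Finset.sum_le_sum fun i _ => hder i).trans_eq ?_
        simp
    _ ≤ ENNReal.ofReal (2 ^ k * (1 + (d : ℝ) ^ k * d)) * ((∫⁻ x, ‖F x‖ₑ ^ 2) + D) := by
        rw [ENNReal.ofReal_mul (by positivity), mul_assoc]
        gcongr
        rw [ENNReal.ofReal_add (by norm_num) (by positivity), ENNReal.ofReal_mul (by positivity),
          ENNReal.ofReal_natCast, ENNReal.ofReal_one, mul_add, add_mul, add_mul, one_mul, one_mul,
          ← mul_assoc (ENNReal.ofReal ((d : ℝ) ^ k))]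
        gcongr
        · exact le_self_add
        · exact le_add_self

lemma normH_mono {s r : ℝ} (h : s ≤ r) (u : Sp d → ℂ) : normH s u ≤ normH r u := by
  unfold normH
  refine ENNReal.rpow_le_rpow (lintegral_mono fun y => ?_) (by norm_num)
  gcongr
  nlinarith [sq_nonneg ‖y‖]

/-- The constant in the embedding of `H^s` into `FL^1`. -/
def embeddingConst (d : ℕ) (s : ℝ) : ℝ≥0∞ :=
  (∫⁻ y : Sp d, ENNReal.ofReal ((1 + ‖y‖ ^ 2) ^ (-s))) ^ (1 / 2 : ℝ)

lemma embeddingConst_ne_top {s : ℝ} (hs : (d : ℝ) / 2 < s) : embeddingConst d s ≠ ⊤ := by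
  refine ENNReal.rpow_ne_top_of_nonneg (by norm_num) ?_
  have h := integrable_rpow_neg_one_add_norm_sq (E := Sp d) (μ := volume) (r := 2 * s)
    (by rw [finrank_euclideanSpace_fin]; linarith)
  have h2 := h.lintegral_lt_top.ne
  convert h2 using 6
  ring

/-- Cauchy–Schwarz with the weights (1+|y|²)^{-s/2} and (1+|y|²)^{(s+j)/2}, whose product
(1+|y|²)^{j/2} dominates |y|^j. -/
lemma lintegral_norm_pow_mul_fourierT_le (F : 𝓢(Sp d, ℂ)) (s : ℝ) (j : ℕ) :
    ∫⁻ y, ENNReal.ofReal (‖y‖ ^ j) * ‖fourierT F y‖ₑ ≤ embeddingConst d s * normH (s + j) F := by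
  have hF := (continuous_fourierT F).enorm.measurable
  have h := ENNReal.lintegral_mul_le_Lp_mul_Lq (volume : Measure (Sp d))
    Real.HolderConjugate.two_two
    (f := fun y => ENNReal.ofReal ((1 + ‖y‖ ^ 2) ^ (-s / 2)))
    (g := fun y => ENNReal.ofReal ((1 + ‖y‖ ^ 2) ^ ((s + j) / 2)) * ‖fourierT F y‖ₑ)
    (by fun_prop) (Measurable.aemeasurable (Measurable.mul (by fun_prop) hF))
  refine (lintegral_mono fun y => ?_).trans (h.trans_eq ?_)
  · rw [Pi.mul_apply, ← mul_assoc]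
    refine mul_le_mul_left ?_ _
    rw [← ENNReal.ofReal_mul (by positivity), ← Real.rpow_add (by positivity)]
    refine ENNReal.ofReal_le_ofReal ?_
    have e : -s / 2 + (s + j) / 2 = (1 / 2) * (j : ℝ) := by ring
    rw [e, Real.rpow_mul (by positivity), Real.rpow_natCast]
    refine pow_le_pow_left₀ (norm_nonneg _) ?_ j
    rw [← Real.sqrt_eq_rpow]
    exact Real.le_sqrt_of_sq_le (by linarith)
  · have h2 : ∀ r : ℝ, ∀ y : Sp d, ENNReal.ofReal ((1 + ‖y‖ ^ 2) ^ (r / 2)) ^ (2 : ℝ) =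
        ENNReal.ofReal ((1 + ‖y‖ ^ 2) ^ r) := by
      intro r y
      rw [ENNReal.ofReal_rpow_of_nonneg (by positivity) (by norm_num),
        ← Real.rpow_mul (by positivity)]
      congr 2
      ring
    simp only [ENNReal.mul_rpow_of_nonneg _ _ (zero_le_two : (0 : ℝ) ≤ 2), h2]
    simp only [ENNReal.rpow_two]
    rfl

lemma normFL1_le_normH (F : 𝓢(Sp d, ℂ)) (s : ℝ) :
    normFL1 F ≤ embeddingConst d s * normH s F := by
  simpa [normFL1] using lintegral_norm_pow_mul_fourierT_le F s 0

lemma normFL1_mderiv_le (F : 𝓢(Sp d, ℂ)) (s : ℝ) {j : ℕ} {α : Fin d → ℕ}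
    (hα : α ∈ multiIndices d j) :
    normFL1 (mderiv α F) ≤ embeddingConst d s * normH (s + j) F := by
  have hαj : ∑ i, α i = j := by simpa [multiIndices] using hα
  obtain ⟨H, hH, hy⟩ := exists_schwartz_mderiv F α
  rw [← hH]
  refine le_trans (lintegral_mono fun y => ?_) (lintegral_norm_pow_mul_fourierT_le F s j)
  rw [← ofReal_norm, ← ofReal_norm, ← ENNReal.ofReal_mul (by positivity), ← hαj]
  exact ENNReal.ofReal_le_ofReal (hy y)

lemma fourierT_Dx (F : 𝓢(Sp d, ℂ)) (j : ℕ) (y : Sp d) :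
    fourierT (Dx j F) y = ∑ α ∈ multiIndices d j, fourierT (mderiv α F) y := by
  unfold fourierT Dx
  rw [← Finset.mul_sum, ← integral_finsetSum]
  · simp only [Finset.mul_sum]
  · intro α _
    refine (integrable_mderiv F α).bdd_mul (c := 1) ?_ ?_
    · exact Continuous.aestronglyMeasurable (by fun_prop)
    · refine Filter.Eventually.of_forall fun x => ?_
      rw [Complex.norm_exp]
      simp

lemma normFL1_Dx_le (F : 𝓢(Sp d, ℂ)) (s : ℝ) (j : ℕ) :
    normFL1 (Dx j F) ≤ (multiIndices d j).card * (embeddingConst d s * normH (s + j) F) := by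
  have hm : ∀ α, Measurable fun y => ‖fourierT (mderiv α F) y‖ₑ := by
    intro α
    obtain ⟨H, hH, -⟩ := exists_schwartz_mderiv F α
    rw [← hH]
    exact (continuous_fourierT H).enorm.measurable
  calc normFL1 (Dx j F) ≤ ∫⁻ y, ∑ α ∈ multiIndices d j, ‖fourierT (mderiv α F) y‖ₑ := by
        refine lintegral_mono fun y => ?_
        rw [fourierT_Dx]
        exact enorm_sum_le _ _
    _ = ∑ α ∈ multiIndices d j, normFL1 (mderiv α F) := lintegral_finsetSum _ fun α _ => hm α
    _ ≤ ∑ α ∈ multiIndices d j, embeddingConst d s * normH (s + j) F :=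
        Finset.sum_le_sum fun α hα => normFL1_mderiv_le F s hα
    _ = _ := by rw [Finset.sum_const, nsmul_eq_mul]

end Fourier

/-! ### Primitives of compactly supported functions along a direction. -/

section RayPrimitive

variable {d : ℕ}

/-- Lebesgue measure on the ray `{sξ : s ≥ 0}`. -/
def rayMeasure (ξ : Sp d) : Measure (Sp d) :=
  (volume.restrict (Set.Iic (0 : ℝ))).map fun s => -(s • ξ)

/-- The primitive `∫_{-∞}^0 g(y + sξ) ds` of `g` in the direction `ξ`. -/
def rayPrim {F : Type} [NormedAddCommGroup F] [NormedSpace ℝ F] (ξ : Sp d) (g : Sp d → F)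
    (y : Sp d) : F :=
  ∫ z, g (y - z) ∂rayMeasure ξ

lemma rayPrim_eq {F : Type} [NormedAddCommGroup F] [NormedSpace ℝ F] (ξ : Sp d) {g : Sp d → F}
    (hg : Continuous g) (y : Sp d) :
    rayPrim ξ g y = ∫ s in Set.Iic (0 : ℝ), g (y + s • ξ) := by
  unfold rayPrim rayMeasure
  rw [integral_map (by fun_prop) (Continuous.aestronglyMeasurable (by fun_prop))]
  simp only [sub_neg_eq_add]

/-- Projecting to the direction ξ shows that a unit-speed line spends time at most 2r in a ball of
radius r, wherever its centre is. -/
lemma rayMeasure_closedBall_le {ξ : Sp d} (hξ : ‖ξ‖ = 1) (y : Sp d) (r : ℝ) :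
    rayMeasure ξ (Metric.closedBall y r) ≤ ENNReal.ofReal (2 * r) := by
  unfold rayMeasure
  rw [Measure.map_apply (by fun_prop) Metric.isClosed_closedBall.measurableSet]
  refine (Measure.restrict_apply_le _ _).trans ?_
  have hsub : (fun s : ℝ => -(s • ξ)) ⁻¹' Metric.closedBall y r ⊆
      Set.Icc (-inner ℝ y ξ - r) (-inner ℝ y ξ + r) := by
    intro s hs
    rw [Set.mem_preimage, Metric.mem_closedBall, dist_eq_norm] at hs
    have h1 : |inner ℝ (-(s • ξ) - y) ξ| ≤ r := by
      refine (abs_real_inner_le_norm _ _).trans ?_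
      rwa [hξ, mul_one]
    rw [inner_sub_left, inner_neg_left, inner_smul_left, real_inner_self_eq_norm_sq, hξ] at h1
    simp only [conj_trivial, one_pow, mul_one] at h1
    rw [abs_le] at h1
    constructor <;> linarith [h1.1, h1.2]
  refine (measure_mono hsub).trans_eq ?_
  rw [Real.volume_Icc]
  congr 1
  ring

lemma isLocallyFiniteMeasure_rayMeasure {ξ : Sp d} (hξ : ‖ξ‖ = 1) :
    IsLocallyFiniteMeasure (rayMeasure ξ) :=
  ⟨fun y => ⟨Metric.closedBall y 1, Metric.closedBall_mem_nhds y one_pos,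
    (rayMeasure_closedBall_le hξ y 1).trans_lt ENNReal.ofReal_lt_top⟩⟩

variable {F : Type} [NormedAddCommGroup F]

lemma integrable_comp_add_smul {ξ : Sp d} (hξ : ‖ξ‖ = 1) {g : Sp d → F} (hg : Continuous g)
    (hc : HasCompactSupport g) (y : Sp d) : Integrable fun s : ℝ => g (y + s • ξ) := by
  refine Continuous.integrable_of_hasCompactSupport (by fun_prop) ?_
  have hemb : Topology.IsClosedEmbedding fun s : ℝ => y + s • ξ := by
    have : Isometry fun s : ℝ => y + s • ξ := by
      refine Isometry.of_dist_eq fun a b => ?_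
      rw [dist_add_left, dist_eq_norm, ← sub_smul, norm_smul, hξ, mul_one, Real.dist_eq,
        Real.norm_eq_abs]
    exact this.isClosedEmbedding
  exact hc.comp_isClosedEmbedding hemb

variable [NormedSpace ℝ F]

/-- With the constant 1 as the other factor, smoothness follows from convolution theory for locally
finite measures. -/
lemma rayPrim_eq_convolution (ξ : Sp d) (g : Sp d → F) :
    rayPrim ξ g = convolution (fun _ => (1 : ℝ)) g (ContinuousLinearMap.lsmul ℝ ℝ)
      (rayMeasure ξ) := by
  ext y
  simp [rayPrim, convolution_def]

lemma contDiff_rayPrim {ξ : Sp d} (hξ : ‖ξ‖ = 1) {g : Sp d → F} (hg : ContDiff ℝ ∞ g)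
    (hc : HasCompactSupport g) : ContDiff ℝ ∞ (rayPrim ξ g) := by
  have := isLocallyFiniteMeasure_rayMeasure hξ
  rw [rayPrim_eq_convolution]
  exact hc.contDiff_convolution_right _ (locallyIntegrable_const _) hg

lemma fderiv_rayPrim [CompleteSpace F] {ξ : Sp d} (hξ : ‖ξ‖ = 1) {g : Sp d → F} (hg : ContDiff ℝ ∞ g)
    (hc : HasCompactSupport g) : fderiv ℝ (rayPrim ξ g) = rayPrim ξ (fderiv ℝ g) := by
  have := isLocallyFiniteMeasure_rayMeasure hξ
  ext1 y
  have hg1 : ContDiff ℝ 1 fun q : ℝ × Sp d => g q.2 :=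
    (hg.of_le (by simp)).comp contDiff_snd
  -- The real parameter is a dummy: the function does not depend on it, and the derivative in y is
  -- recovered by composing with the inclusion of the second factor.
  have h1 := hasFDerivAt_convolution_right_with_param (ContinuousLinearMap.lsmul ℝ ℝ)
    (μ := rayMeasure ξ) (f := fun _ : Sp d => (1 : ℝ)) (g := fun _ : ℝ => g)
    (s := Set.univ) (k := tsupport g) isOpen_univ hc
    (fun _ x _ hx => image_eq_zero_of_notMem_tsupport hx) (locallyIntegrable_const _)
    hg1.contDiffOn (0, y) (Set.mem_univ _)
  have h2 := h1.comp y (hasFDerivAt_prodMk_right (𝕜 := ℝ) (0 : ℝ) y)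
  have h2' : (fun q : ℝ × Sp d => (convolution (fun _ => (1 : ℝ)) g
      (ContinuousLinearMap.lsmul ℝ ℝ) (rayMeasure ξ)) q.2) ∘ (fun x => ((0 : ℝ), x)) =
      rayPrim ξ g := by
    rw [rayPrim_eq_convolution]
    rfl
  rw [h2'] at h2
  have hint : Integrable (fun z => fderiv ℝ g (y - z)) (rayMeasure ξ) := by
    refine Continuous.integrable_of_hasCompactSupport ?_ ?_
    · have := (hg.fderiv_right (m := ∞) (by simp)).continuous
      fun_prop
    · exact (hc.fderiv ℝ).comp_homeomorph (Homeomorph.subLeft y)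
  rw [h2.fderiv, convolution_def]
  have h3 : ∀ z, ((ContinuousLinearMap.lsmul ℝ ℝ : ℝ →L[ℝ] F →L[ℝ] F).precompR (ℝ × Sp d)) 1
      (fderiv ℝ (fun q : ℝ × Sp d => g q.2) (0, y - z)) =
      (fderiv ℝ g (y - z)).comp (ContinuousLinearMap.snd ℝ ℝ (Sp d)) := by
    intro z
    have h4 : HasFDerivAt (fun q : ℝ × Sp d => g q.2) _ (0, y - z) :=
      ((hg.differentiable (by simp)) (y - z)).hasFDerivAt.comp (0, y - z) hasFDerivAt_snd
    rw [h4.fderiv]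
    ext v <;> simp
  have h5 : ∫ z, ((ContinuousLinearMap.lsmul ℝ ℝ : ℝ →L[ℝ] F →L[ℝ] F).precompR (ℝ × Sp d)) 1
      (fderiv ℝ (fun q : ℝ × Sp d => g q.2) (0, y - z)) ∂rayMeasure ξ =
      (rayPrim ξ (fderiv ℝ g) y).comp (ContinuousLinearMap.snd ℝ ℝ (Sp d)) := by
    simp only [h3]
    exact (((ContinuousLinearMap.compL ℝ (ℝ × Sp d) (Sp d) F).flip
      (ContinuousLinearMap.snd ℝ ℝ (Sp d))).integral_comp_comm hint)
  refine Eq.trans (congrArg (fun A : ℝ × Sp d →L[ℝ] F =>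
    A.comp (ContinuousLinearMap.inr ℝ ℝ (Sp d))) h5) ?_
  ext v
  simp

/-- The integrand vanishes outside the ball of radius r around y, whose ray measure is at most 2r.
-/
lemma norm_rayPrim_le {ξ : Sp d} (hξ : ‖ξ‖ = 1) {g : Sp d → F} {r M : ℝ} (hr : 0 ≤ r)
    (hM : ∀ y, ‖g y‖ ≤ M) (hs : Function.support g ⊆ Metric.closedBall 0 r) (y : Sp d) :
    ‖rayPrim ξ g y‖ ≤ 2 * r * M := by
  have hM0 : 0 ≤ M := (norm_nonneg _).trans (hM 0)
  have h1 : rayPrim ξ g y = ∫ z in Metric.closedBall y r, g (y - z) ∂rayMeasure ξ := by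
    rw [rayPrim, setIntegral_eq_integral_of_forall_compl_eq_zero]
    intro z hz
    by_contra hne
    have := hs hne
    rw [mem_closedBall_zero_iff, ← dist_eq_norm, dist_comm] at this
    exact hz this
  have hμ := rayMeasure_closedBall_le hξ y r
  rw [h1]
  refine (norm_setIntegral_le_of_norm_le_const (C := M)
    (hμ.trans_lt ENNReal.ofReal_lt_top) fun z _ => hM _).trans ?_
  rw [mul_comm]
  refine mul_le_mul_of_nonneg_right ?_ hM0
  exact ENNReal.toReal_le_of_le_ofReal (by positivity) hμ

lemma norm_iteratedFDeriv_rayPrim_le [CompleteSpace F] {ξ : Sp d} (hξ : ‖ξ‖ = 1) {r M : ℝ} (hr : 0 ≤ r) (k : ℕ)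
    {g : Sp d → F} (hg : ContDiff ℝ ∞ g) (hc : HasCompactSupport g)
    (hs : tsupport g ⊆ Metric.closedBall 0 r) (hM : ∀ y, ‖iteratedFDeriv ℝ k g y‖ ≤ M)
    (y : Sp d) : ‖iteratedFDeriv ℝ k (rayPrim ξ g) y‖ ≤ 2 * r * M := by
  -- The target space varies because the induction passes from g to its Fréchet derivative.
  induction k generalizing F with
  | zero =>
    simp only [norm_iteratedFDeriv_zero] at hM ⊢
    exact norm_rayPrim_le hξ hr hM ((subset_tsupport g).trans hs) y
  | succ k ih =>
    rw [← norm_iteratedFDeriv_fderiv, fderiv_rayPrim hξ hg hc]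
    refine ih (hg.fderiv_right (by simp)) (hc.fderiv ℝ)
      ((tsupport_fderiv_subset ℝ).trans hs) fun z => ?_
    rw [norm_iteratedFDeriv_fderiv]
    exact hM z

/-- Expresses an integral over an arbitrarily long segment by two values of a bounded function,
which is the source of all bounds uniform in time. -/
lemma rayPrim_add_sub {ξ : Sp d} (hξ : ‖ξ‖ = 1) {g : Sp d → F} (hg : Continuous g)
    (hc : HasCompactSupport g) (y : Sp d) (τ : ℝ) :
    rayPrim ξ g (y + τ • ξ) - rayPrim ξ g y = ∫ s in (0 : ℝ)..τ, g (y + s • ξ) := by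
  have hi := integrable_comp_add_smul hξ hg hc y
  rw [rayPrim_eq ξ hg, rayPrim_eq ξ hg,
    ← intervalIntegral.integral_Iic_sub_Iic hi.integrableOn hi.integrableOn]
  congr 1
  have h := (measurePreserving_add_right (volume : Measure ℝ) τ).setIntegral_preimage_emb
    (measurableEmbedding_addRight τ) (fun s : ℝ => g (y + s • ξ)) (Set.Iic τ)
  rw [Set.preimage_add_const_Iic, sub_self] at h
  rw [← h]
  refine integral_congr_ae (Filter.Eventually.of_forall fun s => ?_)
  beta_reduce
  rw [add_smul, add_assoc, add_comm (τ • ξ)]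

end RayPrimitive

/-! ### Factoring r out of the nonlinearity. -/

section PowerSeries

/-- A convergent power series without constant term is `r` times a smooth compactly supported
function near the origin. -/
lemma exists_smooth_factor {G : ℝ → ℝ} {R : ℝ} {c : ℕ → ℝ} (hR : 0 < R) (hc : c 0 = 0)
    (hG : ∀ r : ℝ, 0 ≤ r → r < R → HasSum (fun k : ℕ => c k * r ^ k) (G r)) :
    ∃ H : ℝ → ℝ, ContDiff ℝ ∞ H ∧ HasCompactSupport H ∧
      ∀ r, 0 ≤ r → r ≤ R / 4 → G r = r * H r := by
  set q : FormalMultilinearSeries ℝ ℝ ℝ :=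
    FormalMultilinearSeries.ofScalars ℝ fun k => c (k + 1) with hq
  -- Here q is the series of G(r)/r. Its terms at 3R/4 tend to zero because the series of G
  -- converges there.
  have hrad : ENNReal.ofReal (3 * R / 4) ≤ q.radius := by
    rw [ENNReal.ofReal]
    refine q.le_radius_of_tendsto (l := 0) ?_
    have h1 := (hG (3 * R / 4) (by positivity) (by linarith)).summable.tendsto_atTop_zero
    have h2 := ((Filter.tendsto_add_atTop_iff_nat 1).2 h1).norm.div_const (3 * R / 4)
    rw [norm_zero, zero_div] at h2
    refine h2.congr fun k => ?_
    rw [hq, FormalMultilinearSeries.ofScalars_norm, Real.coe_toNNReal _ (by positivity), norm_mul,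
      norm_pow, Real.norm_of_nonneg (by positivity : (0 : ℝ) ≤ 3 * R / 4)]
    rw [pow_succ]
    field_simp
  have hpos : 0 < q.radius := lt_of_lt_of_le (by simpa using hR) hrad
  have hq0 : HasFPowerSeriesOnBall q.sum q 0 q.radius := q.hasFPowerSeriesOnBall hpos
  have hmem : ∀ r : ℝ, |r| < 3 * R / 4 → r ∈ Metric.eball (0 : ℝ) q.radius := by
    intro r hr
    rw [Metric.mem_eball, edist_zero_right, ← ofReal_norm, Real.norm_eq_abs]
    exact ((ENNReal.ofReal_lt_ofReal_iff (by positivity)).2 hr).trans_le hrad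
  -- The cutoff is 1 up to R/4 and vanishes from R/2 on, inside the region |r| < 3R/4 where the sum
  -- is known to be analytic.
  let χ : ContDiffBump (0 : ℝ) := ⟨R / 4, R / 2, by positivity, by linarith⟩
  refine ⟨fun r => χ r * q.sum r, ?_, χ.hasCompactSupport.mul_right, ?_⟩
  · rw [contDiff_iff_contDiffAt]
    intro r
    by_cases hr : |r| < 3 * R / 4
    · exact χ.contDiff.contDiffAt.mul (hq0.analyticAt_of_mem (hmem r hr)).contDiffAt
    · have h0 : (fun r => χ r * q.sum r) =ᶠ[nhds r] fun _ => 0 := by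
        have hev : ∀ᶠ x in nhds r, R / 2 < |x| :=
          continuous_abs.continuousAt.eventually (lt_mem_nhds (by linarith))
        filter_upwards [hev] with x hx
        rw [χ.zero_of_le_dist (by rw [Real.dist_eq, sub_zero]; exact hx.le), zero_mul]
      exact contDiffAt_const.congr_of_eventuallyEq h0
  · intro r hr0 hr
    have hχ : χ r = 1 := χ.one_of_mem_closedBall (by
      rw [mem_closedBall_zero_iff, Real.norm_eq_abs, abs_of_nonneg hr0]
      exact hr)
    have hs := hq0.hasSum (y := r) (hmem r (by rw [abs_of_nonneg hr0]; linarith))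
    rw [zero_add] at hs
    have h1 : HasSum (fun k => c (k + 1) * r ^ k) (q.sum r) := by
      refine hs.congr_fun ?_
      intro k
      simp [hq, mul_comm]
    have h2 : HasSum (fun k => c (k + 1) * r ^ (k + 1)) (r * q.sum r) := by
      refine (h1.mul_left r).congr_fun ?_
      intro k
      ring
    have h3 := (hasSum_nat_add_iff' 1).2 (hG r hr0 (by linarith))
    rw [Finset.sum_range_one, hc, zero_mul, sub_zero] at h3
    simp only [h3.unique h2, hχ, one_mul]

end PowerSeries

/-! ### Calculus of families with uniformly bounded derivatives. -/

section UnifSmooth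

variable {ι E F G H : Type*} [NormedAddCommGroup E] [NormedSpace ℝ E]
  [NormedAddCommGroup F] [NormedSpace ℝ F] [NormedAddCommGroup G] [NormedSpace ℝ G]
  [NormedAddCommGroup H] [NormedSpace ℝ H]

/-- A family of smooth functions with derivatives of every order bounded uniformly. -/
def UnifSmooth (f : ι → E → F) : Prop :=
  (∀ i, ContDiff ℝ ∞ (f i)) ∧ ∀ k : ℕ, ∃ C : ℝ, ∀ i y, ‖iteratedFDeriv ℝ k (f i) y‖ ≤ C

lemma UnifSmooth.bilin {f : ι → E → F} {g : ι → E → G} (hf : UnifSmooth f) (hg : UnifSmooth g)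
    (B : F →L[ℝ] G →L[ℝ] H) : UnifSmooth fun i y => B (f i y) (g i y) := by
  choose Cf hCf using hf.2
  choose Cg hCg using hg.2
  refine ⟨fun i => B.isBoundedBilinearMap.contDiff.comp₂ (hf.1 i) (hg.1 i), fun k =>
    ⟨‖B‖ * ∑ j ∈ Finset.range (k + 1), (k.choose j : ℝ) * Cf j * Cg (k - j), fun i y => ?_⟩⟩
  refine (B.norm_iteratedFDeriv_le_of_bilinear (hf.1 i) (hg.1 i) y (mod_cast le_top)).trans ?_
  have h : ∀ j, 0 ≤ Cf j := fun j => (norm_nonneg _).trans (hCf j i y)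
  gcongr with j hj
  · exact mul_nonneg (Nat.cast_nonneg _) (h j)
  · exact hCf j i y
  · exact hCg (k - j) i y

/-- The outer derivatives need only be bounded at the values taken by the inner functions; this
matters for `expQuot`, which has no bound uniform in both ρ and s. -/
lemma UnifSmooth.comp {f : ι → E → F} {g : ι → F → G} (hf : UnifSmooth f)
    (hg : ∀ i, ContDiff ℝ ∞ (g i))
    (hgb : ∀ k : ℕ, ∃ C : ℝ, ∀ i y, ‖iteratedFDeriv ℝ k (g i) (f i y)‖ ≤ C) :
    UnifSmooth fun i y => g i (f i y) := by
  choose Cf hCf using hf.2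
  choose Cg hCg using hgb
  refine ⟨fun i => (hg i).comp (hf.1 i), fun k =>
    ⟨k.factorial * (∑ j ∈ Finset.range (k + 1), |Cg j|) *
      (1 + ∑ j ∈ Finset.range (k + 1), |Cf j|) ^ k, fun i y => ?_⟩⟩
  have hsum : ∀ (c : ℕ → ℝ) (j : ℕ), j ≤ k → c j ≤ ∑ j ∈ Finset.range (k + 1), |c j| :=
    fun c j hj => (le_abs_self _).trans (Finset.single_le_sum (f := fun j => |c j|)
      (fun _ _ => abs_nonneg _) (Finset.mem_range.2 (Nat.lt_succ_of_le hj)))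
  refine norm_iteratedFDeriv_comp_le (hg i) (hf.1 i) (mod_cast le_top) y
    (fun j hj => (hCg j i y).trans (hsum Cg j hj)) fun j hj1 hj => ?_
  -- The composition estimate wants the j-th inner derivative bounded by the j-th power of one
  -- number; a number at least 1 that dominates all the bounds will do.
  have h1 : (1 : ℝ) ≤ 1 + ∑ j ∈ Finset.range (k + 1), |Cf j| :=
    le_add_of_nonneg_right (Finset.sum_nonneg fun _ _ => abs_nonneg _)
  calc ‖iteratedFDeriv ℝ j (f i) y‖ ≤ 1 + ∑ j ∈ Finset.range (k + 1), |Cf j| := by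
        linarith [hCf j i y, hsum Cf j hj]
    _ ≤ _ := le_self_pow₀ h1 (by omega)

/-- Contractions only shrink derivatives and translations do not change their suprema, so the shift
b may depend on the parameter without restriction. -/
lemma UnifSmooth.comp_affine {f : ι → E → F} (hf : UnifSmooth f) {s : ι → ℝ} (b : ι → E)
    (hs : ∀ i, |s i| ≤ 1) : UnifSmooth fun i y => f i (s i • y + b i) := by
  refine ⟨fun i => (hf.1 i).comp (by fun_prop), fun k => ?_⟩
  obtain ⟨C, hC⟩ := hf.2 k
  refine ⟨C, fun i y => ?_⟩
  have h1 : ContDiff ℝ k fun z => f i (z + b i) :=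
    ((hf.1 i).of_le (mod_cast le_top)).comp (by fun_prop)
  rw [iteratedFDeriv_comp_const_smul (s i) h1]
  beta_reduce
  rw [iteratedFDeriv_comp_add_right, norm_smul, norm_pow, Real.norm_eq_abs]
  exact (mul_le_of_le_one_left (norm_nonneg _) (pow_le_one₀ (abs_nonneg _) (hs i))).trans (hC i _)

lemma UnifSmooth.sub {f g : ι → E → F} (hf : UnifSmooth f) (hg : UnifSmooth g) :
    UnifSmooth fun i y => f i y - g i y := by
  refine ⟨fun i => (hf.1 i).sub (hg.1 i), fun k => ?_⟩
  obtain ⟨C, hC⟩ := hf.2 k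
  obtain ⟨D, hD⟩ := hg.2 k
  refine ⟨C + D, fun i y => ?_⟩
  have h := iteratedFDeriv_sub_apply (x := y) (((hf.1 i).of_le (mod_cast le_top) :
    ContDiff ℝ k (f i)).contDiffAt) (((hg.1 i).of_le (mod_cast le_top) :
    ContDiff ℝ k (g i)).contDiffAt)
  change ‖iteratedFDeriv ℝ k (f i - g i) y‖ ≤ _
  rw [h]
  exact (norm_sub_le _ _).trans (add_le_add (hC i y) (hD i y))

lemma UnifSmooth.const_smul {f : ι → E → F} (hf : UnifSmooth f) {s : ι → ℝ}
    (hs : ∀ i, |s i| ≤ 1) : UnifSmooth fun i y => s i • f i y := by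
  refine ⟨fun i => contDiff_const.smul (hf.1 i), fun k => ?_⟩
  obtain ⟨C, hC⟩ := hf.2 k
  refine ⟨C, fun i y => ?_⟩
  rw [iteratedFDeriv_const_smul_apply' ((hf.1 i).of_le (mod_cast le_top) :
    ContDiff ℝ k (f i)).contDiffAt, norm_smul, Real.norm_eq_abs]
  exact (mul_le_of_le_one_left (norm_nonneg _) (hs i)).trans (hC i _)

lemma UnifSmooth.of_schwartz (a : 𝓢(E, F)) : UnifSmooth fun _ : ι => a :=
  ⟨fun _ => a.smooth ⊤, fun k => ⟨SchwartzMap.seminorm ℝ 0 k a, fun _ y =>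
    SchwartzMap.norm_iteratedFDeriv_le_seminorm ℝ a k y⟩⟩

lemma exists_bound_iteratedFDeriv {f : E → F} (hf : ContDiff ℝ ∞ f) (hc : HasCompactSupport f)
    (k : ℕ) : ∃ C : ℝ, ∀ y, ‖iteratedFDeriv ℝ k f y‖ ≤ C :=
  (hc.iteratedFDeriv k).exists_bound_of_continuous (hf.continuous_iteratedFDeriv (mod_cast le_top))

end UnifSmooth

/-! ### The rescaled exponential, uniformly in the small parameter. -/

section ExpQuot

/-- The difference quotient `(e^{-iρs} - 1) / ρ`. -/
def expQuot (ρ s : ℝ) : ℂ := (Complex.exp (-Complex.I * (ρ * s : ℝ)) - 1) / ρ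

lemma exp_eq_one_add_expQuot {ρ : ℝ} (hρ : ρ ≠ 0) (s : ℝ) :
    Complex.exp (-Complex.I * (ρ * s : ℝ)) = 1 + ρ * expQuot ρ s := by
  have : (ρ : ℂ) ≠ 0 := by exact_mod_cast hρ
  rw [expQuot]
  field_simp
  ring

lemma expQuot_zero (ρ : ℝ) : expQuot ρ 0 = 0 := by simp [expQuot]

lemma contDiff_expQuot (ρ : ℝ) : ContDiff ℝ ∞ (expQuot ρ) := by
  unfold expQuot
  have h : ContDiff ℝ ∞ fun s : ℝ => ((ρ * s : ℝ) : ℂ) :=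
    Complex.ofRealCLM.contDiff.comp (contDiff_const.mul contDiff_id)
  fun_prop

lemma norm_expQuot_le {ρ : ℝ} (hρ : 0 < ρ) (s : ℝ) : ‖expQuot ρ s‖ ≤ |s| := by
  have h := Real.norm_exp_I_mul_ofReal_sub_one_le (x := -(ρ * s))
  rw [expQuot, norm_div, Complex.norm_real, Real.norm_of_nonneg hρ.le, div_le_iff₀ hρ]
  have e : -Complex.I * ((ρ * s : ℝ) : ℂ) = Complex.I * ((-(ρ * s) : ℝ) : ℂ) := by
    push_cast; ring
  rw [e]
  refine h.trans_eq ?_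
  rw [norm_neg, norm_mul, Real.norm_of_nonneg hρ.le, Real.norm_eq_abs, mul_comm]

lemma iteratedDeriv_succ_expQuot {ρ : ℝ} (hρ : ρ ≠ 0) (k : ℕ) :
    iteratedDeriv (k + 1) (expQuot ρ) = fun s : ℝ =>
      (-Complex.I) ^ (k + 1) * (ρ : ℂ) ^ k * Complex.exp (-Complex.I * (ρ * s : ℝ)) := by
  have hρ' : (ρ : ℂ) ≠ 0 := by exact_mod_cast hρ
  have hexp : ∀ s : ℝ, HasDerivAt (fun s : ℝ => Complex.exp (-Complex.I * (ρ * s : ℝ)))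
      (-Complex.I * ρ * Complex.exp (-Complex.I * (ρ * s : ℝ))) s := by
    intro s
    have h1 : HasDerivAt (fun s : ℝ => ((ρ * s : ℝ) : ℂ)) (ρ : ℂ) s := by
      simpa using (((hasDerivAt_id s).const_mul ρ).ofReal_comp)
    refine (h1.const_mul (-Complex.I)).cexp.congr_deriv ?_
    ring
  induction k with
  | zero =>
    ext s
    rw [zero_add, iteratedDeriv_one]
    have h : HasDerivAt (expQuot ρ) _ s := ((hexp s).sub_const 1).div_const (ρ : ℂ)
    rw [h.deriv]
    field_simp
  | succ k ih =>
    ext s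
    rw [iteratedDeriv_succ, ih,
      ((hexp s).const_mul ((-Complex.I) ^ (k + 1) * (ρ : ℂ) ^ k)).deriv]
    ring

/-- Dividing by ρ is harmless: the value is handled by |e^{iθ} - 1| ≤ |θ|, and a derivative of order
k + 1 carries ρ^k ≤ 1. -/
lemma norm_iteratedFDeriv_expQuot_le {ρ : ℝ} (hρ : 0 < ρ) (hρ1 : ρ ≤ 1) (k : ℕ) (s : ℝ) :
    ‖iteratedFDeriv ℝ k (expQuot ρ) s‖ ≤ |s| + 1 := by
  rw [norm_iteratedFDeriv_eq_norm_iteratedDeriv]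
  rcases k with _ | k
  · rw [iteratedDeriv_zero]
    linarith [norm_expQuot_le hρ s]
  · rw [iteratedDeriv_succ_expQuot hρ.ne']
    have h : ‖Complex.exp (-Complex.I * (ρ * s : ℝ))‖ = 1 := by
      rw [Complex.norm_exp]
      simp
    rw [norm_mul, norm_mul, norm_pow, norm_neg, Complex.norm_I, one_pow, one_mul, h, mul_one,
      norm_pow, Complex.norm_real, Real.norm_of_nonneg hρ.le]
    linarith [pow_le_one₀ hρ.le hρ1 (n := k), abs_nonneg s]

end ExpQuot

/-! ### The corrector, its uniform bounds and its support in a tube. -/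

section Corrector

variable {d : ℕ}

/-- The parameters: `ε ∈ (0, 1]`, a unit vector `ξ` and a rescaled time `τ`. -/
abbrev Params (d : ℕ) : Type := {q : ℝ × Sp d × ℝ // 0 < q.1 ∧ q.1 ≤ 1 ∧ ‖q.2.1‖ = 1}

/-- The integral of `β` over the segment from `y - Tξ - τξ` to `y - Tξ`. -/
def rayIntegral (T : ℝ) (β : Sp d → ℝ) (ξ : Sp d) (τ : ℝ) (y : Sp d) : ℝ :=
  rayPrim ξ β (y - T • ξ) - rayPrim ξ β (y - T • ξ - τ • ξ)

/-- With `ρ = ε^{2p}`, the function `(e^{-iρh} - 1) / ρ`, where `ρh` is the phase of the amplitude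
in the variable `y`, `x = εy`. -/
def corrector (p T : ℝ) (β : Sp d → ℝ) (H : ℝ → ℝ) (a₀ : Sp d → ℂ) (ε : ℝ) (ξ : Sp d) (τ : ℝ)
    (y : Sp d) : ℂ :=
  expQuot (ε ^ (2 * p)) (‖a₀ (ε • y)‖ ^ 2 * H (ε ^ (2 * p) * ‖a₀ (ε • y)‖ ^ 2) *
    rayIntegral T β ξ τ y)

/-- A difference of two translates of one primitive. The time τ enters only as a translation, so the
bounds do not see it. -/
lemma unifSmooth_rayIntegral (T : ℝ) {β : Sp d → ℝ} (hβ : ContDiff ℝ ∞ β)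
    (hc : HasCompactSupport β) :
    UnifSmooth fun q : Params d => rayIntegral T β q.1.2.1 q.1.2.2 := by
  obtain ⟨r, hr⟩ := hc.isCompact.isBounded.subset_closedBall 0
  have hr' : tsupport β ⊆ Metric.closedBall 0 (max r 0) :=
    hr.trans (Metric.closedBall_subset_closedBall (le_max_left _ _))
  have h : UnifSmooth fun q : Params d => rayPrim q.1.2.1 β := by
    refine ⟨fun q => contDiff_rayPrim q.2.2.2 hβ hc, fun k => ?_⟩
    obtain ⟨M, hM⟩ := exists_bound_iteratedFDeriv hβ hc k
    exact ⟨2 * max r 0 * M, fun q y =>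
      norm_iteratedFDeriv_rayPrim_le q.2.2.2 (le_max_right _ _) k hβ hc hr' hM y⟩
  have h1 := h.comp_affine (s := fun _ => 1) (fun q => -(T • q.1.2.1)) (by simp)
  have h2 := h.comp_affine (s := fun _ => 1) (fun q => -(T • q.1.2.1) - q.1.2.2 • q.1.2.1)
    (by simp)
  convert h1.sub h2 using 2 with q
  ext y
  rw [rayIntegral, one_smul, ← sub_eq_add_neg, ← add_sub_assoc, ← sub_eq_add_neg]

/-- In the variable y the amplitude a₀(εy) varies slowly: every dilation factor involved is at most
1, so products and compositions keep uniform bounds. -/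
lemma unifSmooth_corrector {p : ℝ} (hp : 0 < p) (T : ℝ) {β : Sp d → ℝ} (hβ : ContDiff ℝ ∞ β)
    (hc : HasCompactSupport β) {H : ℝ → ℝ} (hH : ContDiff ℝ ∞ H) (hHc : HasCompactSupport H)
    (a₀ : 𝓢(Sp d, ℂ)) :
    UnifSmooth fun q : Params d => corrector p T β H a₀ q.1.1 q.1.2.1 q.1.2.2 := by
  have hε : ∀ q : Params d, |q.1.1| ≤ 1 := fun q => by
    rw [abs_of_pos q.2.1]; exact q.2.2.1
  have hρ0 : ∀ q : Params d, 0 < q.1.1 ^ (2 * p) := fun q => Real.rpow_pos_of_pos q.2.1 _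
  have hρ1 : ∀ q : Params d, q.1.1 ^ (2 * p) ≤ 1 := fun q =>
    Real.rpow_le_one q.2.1.le q.2.2.1 (by positivity)
  have h1 : UnifSmooth fun (q : Params d) y => a₀ (q.1.1 • y) := by
    simpa using (UnifSmooth.of_schwartz (ι := Params d) a₀).comp_affine (fun _ => 0) hε
  have h2 : UnifSmooth fun (q : Params d) y => ‖a₀ (q.1.1 • y)‖ ^ 2 := by
    have e : ∀ w : ℂ, innerSL ℝ w w = ‖w‖ ^ 2 := fun w => real_inner_self_eq_norm_sq w
    have := h1.bilin h1 (innerSL ℝ)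
    simpa only [e] using this
  have h3 : UnifSmooth fun (q : Params d) y => H (q.1.1 ^ (2 * p) * ‖a₀ (q.1.1 • y)‖ ^ 2) := by
    refine (h2.const_smul (s := fun q => q.1.1 ^ (2 * p)) fun q => ?_).comp (fun _ => hH) fun k => ?_
    · rw [abs_of_pos (hρ0 q)]; exact hρ1 q
    · obtain ⟨C, hC⟩ := exists_bound_iteratedFDeriv hH hHc k
      exact ⟨C, fun q y => hC _⟩
  have h4 := (h2.bilin h3 (ContinuousLinearMap.mul ℝ ℝ)).bilin (unifSmooth_rayIntegral T hβ hc)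
    (ContinuousLinearMap.mul ℝ ℝ)
  simp only [ContinuousLinearMap.mul_apply'] at h4
  -- The order-zero bound confines the argument of `expQuot` to |s| ≤ M, where its derivatives are
  -- bounded uniformly in ρ.
  obtain ⟨M, hM⟩ := h4.2 0
  refine UnifSmooth.comp (g := fun q : Params d => expQuot (q.1.1 ^ (2 * p))) h4
    (fun q => contDiff_expQuot _) fun k => ⟨M + 1, fun q y => ?_⟩
  refine (norm_iteratedFDeriv_expQuot_le (hρ0 q) (hρ1 q) k _).trans ?_
  have := hM q y
  rw [norm_iteratedFDeriv_zero, Real.norm_eq_abs] at this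
  linarith

/-- The closed tube of radius `r` around the line `ℝξ`. -/
def tube (ξ : Sp d) (r : ℝ) : Set (Sp d) := {z | ‖z - (inner ℝ z ξ : ℝ) • ξ‖ ≤ r}

lemma isClosed_tube (ξ : Sp d) (r : ℝ) : IsClosed (tube ξ r) :=
  isClosed_le (by fun_prop) continuous_const

/-- Pythagoras: translating along ξ does not change the component orthogonal to ξ. -/
lemma mem_tube_of_norm_add_smul_le {ξ : Sp d} (hξ : ‖ξ‖ = 1) {r s : ℝ} {y : Sp d}
    (h : ‖y + s • ξ‖ ≤ r) : y ∈ tube ξ r := by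
  refine le_trans ?_ h
  have e : y + s • ξ = (y - (inner ℝ y ξ : ℝ) • ξ) + (s + inner ℝ y ξ) • ξ := by
    rw [add_smul]; abel
  have horth : inner ℝ (y - (inner ℝ y ξ : ℝ) • ξ) ((s + inner ℝ y ξ) • ξ) = (0 : ℝ) := by
    rw [inner_smul_right, inner_sub_left, inner_smul_left, real_inner_self_eq_norm_sq, hξ]
    simp
  have hsq := norm_add_sq_eq_norm_sq_add_norm_sq_of_inner_eq_zero _ _ horth
  rw [e]
  refine abs_le_of_sq_le_sq' ?_ (norm_nonneg _) |>.2
  nlinarith [norm_nonneg ((s + inner ℝ y ξ) • ξ)]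

lemma rayIntegral_eq_zero {T : ℝ} {β : Sp d → ℝ} (hβ : Continuous β)
    (hc : HasCompactSupport β) {r : ℝ} (hr : tsupport β ⊆ Metric.closedBall 0 r)
    {ξ : Sp d} (hξ : ‖ξ‖ = 1) (τ : ℝ) {y : Sp d} (hy : y ∉ tube ξ r) :
    rayIntegral T β ξ τ y = 0 := by
  have h := rayPrim_add_sub hξ hβ hc (y - T • ξ - τ • ξ) τ
  rw [sub_add_cancel] at h
  rw [rayIntegral, h]
  have h0 : ∀ s : ℝ, β (y - T • ξ - τ • ξ + s • ξ) = 0 := by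
    intro s
    by_contra hne
    have h1 := hr (subset_tsupport β hne)
    rw [mem_closedBall_zero_iff] at h1
    have e : y - T • ξ - τ • ξ + s • ξ = y + (-T - τ + s) • ξ := by module
    rw [e] at h1
    exact hy (mem_tube_of_norm_add_smul_le hξ h1)
  simp [h0]

lemma smul_mem_tube_iff {ξ : Sp d} {r ε : ℝ} (hε : 0 < ε) {z : Sp d} :
    ε⁻¹ • z ∈ tube ξ r ↔ z ∈ tube ξ (r * ε) := by
  have e : ε⁻¹ • z - (inner ℝ (ε⁻¹ • z) ξ : ℝ) • ξ = ε⁻¹ • (z - (inner ℝ z ξ : ℝ) • ξ) := by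
    rw [inner_smul_left, smul_sub, smul_smul]
    rfl
  simp only [tube, Set.mem_ofPred_eq]
  rw [e, norm_smul, norm_inv, Real.norm_of_nonneg hε.le, inv_mul_le_iff₀ hε, mul_comm]

/-- The amplitude in the coordinate `z` moving with the wave packet. -/
def profile (p T : ℝ) (β : Sp d → ℝ) (H : ℝ → ℝ) (a₀ : Sp d → ℂ) (ε : ℝ) (ξ : Sp d) (τ : ℝ)
    (z : Sp d) : ℂ :=
  a₀ z + (ε ^ (2 * p)) • (a₀ z * corrector p T β H a₀ ε ξ τ (ε⁻¹ • z))

lemma exists_schwartz_decay (a₀ : 𝓢(Sp d, ℂ)) (N k : ℕ) :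
    ∃ C : ℝ, ∀ z, (1 + ‖z‖) ^ N * ‖iteratedFDeriv ℝ k a₀ z‖ ≤ C :=
  ⟨_, fun z => SchwartzMap.one_add_le_sup_seminorm_apply (𝕜 := ℝ) (m := (N, k)) le_rfl le_rfl a₀ z⟩

/-- Pointwise bounds for the derivatives of the profile: the correction has size `ε^{2p-k}` and
lives in a tube of radius comparable to `ε`. -/
lemma exists_bound_profile {p : ℝ} (hp : 0 < p) (T : ℝ) {β : Sp d → ℝ} (hβ : ContDiff ℝ ∞ β)
    (hc : HasCompactSupport β) {H : ℝ → ℝ} (hH : ContDiff ℝ ∞ H) (hHc : HasCompactSupport H)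
    (a₀ : 𝓢(Sp d, ℂ)) {r : ℝ} (hr : tsupport β ⊆ Metric.closedBall 0 r) (N k : ℕ) :
    ∃ C : ℝ, 0 ≤ C ∧ ∀ ε : ℝ, 0 < ε → ε ≤ 1 → ∀ ξ : Sp d, ‖ξ‖ = 1 → ∀ (τ : ℝ) (z : Sp d),
      (1 + ‖z‖) ^ N * ‖iteratedFDeriv ℝ k (profile p T β H a₀ ε ξ τ) z‖ ≤
        C * (1 + ε ^ (2 * p) * ε⁻¹ ^ k * (tube ξ (r * ε)).indicator 1 z) := by
  have hQ := unifSmooth_corrector hp T hβ hc hH hHc a₀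
  choose CQ hCQ using hQ.2
  choose Ca hCa using fun k => exists_schwartz_decay a₀ N k
  have hCa0 : ∀ k, 0 ≤ Ca k := fun k => le_trans (by positivity) (hCa k 0)
  set S : ℝ := ∑ j ∈ Finset.range (k + 1), (k.choose j : ℝ) * Ca j * |CQ (k - j)| with hS
  have hS0 : 0 ≤ S := Finset.sum_nonneg fun j _ =>
    mul_nonneg (mul_nonneg (Nat.cast_nonneg _) (hCa0 j)) (abs_nonneg _)
  refine ⟨Ca k + S, add_nonneg (hCa0 k) hS0, fun ε hε hε1 ξ hξ τ z => ?_⟩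
  set Q := corrector p T β H a₀ ε ξ τ with hQdef
  have hQs : ContDiff ℝ ∞ Q := hQ.1 ⟨(ε, ξ, τ), hε, hε1, hξ⟩
  have hQε : ContDiff ℝ ∞ fun z : Sp d => Q (ε⁻¹ • z) := hQs.comp (by fun_prop)
  have hρ : 0 < ε ^ (2 * p) := Real.rpow_pos_of_pos hε _
  have hinv : 1 ≤ ε⁻¹ := (one_le_inv₀ hε).2 hε1
  have hprod : ContDiff ℝ ∞ fun z => a₀ z * Q (ε⁻¹ • z) := (a₀.smooth ⊤).mul hQε
  have hsplit : iteratedFDeriv ℝ k (profile p T β H a₀ ε ξ τ) z = iteratedFDeriv ℝ k a₀ z +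
      (ε ^ (2 * p)) • iteratedFDeriv ℝ k (fun z => a₀ z * Q (ε⁻¹ • z)) z := by
    have h1 : ContDiffAt ℝ k (fun z => a₀ z * Q (ε⁻¹ • z)) z :=
      (hprod.of_le (mod_cast le_top)).contDiffAt
    rw [← iteratedFDeriv_const_smul_apply' h1]
    have h2 : ContDiffAt ℝ k (fun z => (ε ^ (2 * p)) • (a₀ z * Q (ε⁻¹ • z))) z :=
      h1.const_smul _
    exact iteratedFDeriv_add_apply ((a₀.smooth k).contDiffAt) h2
  have hb : (1 + ‖z‖) ^ N * ‖iteratedFDeriv ℝ k (fun z => a₀ z * Q (ε⁻¹ • z)) z‖ ≤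
      S * (ε⁻¹ ^ k * (tube ξ (r * ε)).indicator 1 z) := by
    by_cases hz : z ∈ tube ξ (r * ε)
    · rw [Set.indicator_of_mem hz, Pi.one_apply, mul_one]
      have hL := norm_iteratedFDeriv_mul_le (n := k) (a₀.smooth ⊤) hQε z (mod_cast le_top)
      refine (mul_le_mul_of_nonneg_left hL (by positivity)).trans ?_
      rw [hS, Finset.mul_sum, Finset.sum_mul]
      refine Finset.sum_le_sum fun j _ => ?_
      have hle : ∀ m : ℕ, (m : WithTop ℕ∞) ≤ ((⊤ : ℕ∞) : WithTop ℕ∞) := fun m => mod_cast le_top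
      have hQj : ContDiff ℝ (k - j : ℕ) Q := hQs.of_le (hle _)
      rw [iteratedFDeriv_comp_const_smul ε⁻¹ hQj]
      beta_reduce
      rw [norm_smul, norm_pow, Real.norm_of_nonneg (by positivity : 0 ≤ ε⁻¹)]
      have h1 := hCa j z
      have h2 : ‖iteratedFDeriv ℝ (k - j) Q (ε⁻¹ • z)‖ ≤ |CQ (k - j)| :=
        (hCQ (k - j) ⟨(ε, ξ, τ), hε, hε1, hξ⟩ (ε⁻¹ • z)).trans (le_abs_self _)
      -- In the Leibniz rule the worst term puts all k derivatives on the corrector.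
      have h3 : ε⁻¹ ^ (k - j) ≤ ε⁻¹ ^ k := pow_le_pow_right₀ hinv (Nat.sub_le k j)
      calc (1 + ‖z‖) ^ N * ((k.choose j : ℝ) * ‖iteratedFDeriv ℝ j a₀ z‖ *
            (ε⁻¹ ^ (k - j) * ‖iteratedFDeriv ℝ (k - j) Q (ε⁻¹ • z)‖))
          = (k.choose j : ℝ) * ((1 + ‖z‖) ^ N * ‖iteratedFDeriv ℝ j a₀ z‖) *
            (ε⁻¹ ^ (k - j) * ‖iteratedFDeriv ℝ (k - j) Q (ε⁻¹ • z)‖) := by ring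
        _ ≤ (k.choose j : ℝ) * Ca j * (ε⁻¹ ^ k * |CQ (k - j)|) := by
            have := hCa0 j
            gcongr
        _ = _ := by ring
    · have hsupp : tsupport (fun z => a₀ z * Q (ε⁻¹ • z)) ⊆ tube ξ (r * ε) := by
        refine closure_minimal (fun x hx => ?_) (isClosed_tube _ _)
        by_contra hxt
        refine hx ?_
        have h0 : rayIntegral T β ξ τ (ε⁻¹ • x) = 0 :=
          rayIntegral_eq_zero hβ.continuous hc hr hξ τ (by rwa [smul_mem_tube_iff hε])
        simp only [hQdef, corrector, h0, mul_zero, expQuot_zero]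
      have h0 : iteratedFDeriv ℝ k (fun z => a₀ z * Q (ε⁻¹ • z)) z = 0 := by
        by_contra hne
        exact hz (hsupp (support_iteratedFDeriv_subset k hne))
      rw [h0, Set.indicator_of_notMem hz]
      simp
  rw [hsplit]
  have hI : 0 ≤ (tube ξ (r * ε)).indicator (1 : Sp d → ℝ) z :=
    Set.indicator_nonneg (fun _ _ => zero_le_one) z
  calc _ ≤ (1 + ‖z‖) ^ N * (‖iteratedFDeriv ℝ k a₀ z‖ + ε ^ (2 * p) *
        ‖iteratedFDeriv ℝ k (fun z => a₀ z * Q (ε⁻¹ • z)) z‖) := by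
        gcongr
        refine (norm_add_le _ _).trans_eq ?_
        rw [norm_smul, Real.norm_of_nonneg hρ.le]
    _ = (1 + ‖z‖) ^ N * ‖iteratedFDeriv ℝ k a₀ z‖ + ε ^ (2 * p) * ((1 + ‖z‖) ^ N *
        ‖iteratedFDeriv ℝ k (fun z => a₀ z * Q (ε⁻¹ • z)) z‖) := by ring
    _ ≤ Ca k + ε ^ (2 * p) * (S * (ε⁻¹ ^ k * (tube ξ (r * ε)).indicator 1 z)) := by
        gcongr
        exact hCa k z
    _ ≤ _ := by
        have h5 : 0 ≤ ε ^ (2 * p) * ε⁻¹ ^ k * (tube ξ (r * ε)).indicator 1 z := by positivity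
        nlinarith [mul_nonneg (hCa0 k) h5]

end Corrector

/-! ### Weighted volume of thin tubes. -/

section TubeIntegral

variable {d : ℕ}

/-- The weight `(1 + |z|)^{-2(d+1)}`. -/
def weight (d : ℕ) (s : ℝ) : ℝ := (1 + s) ^ (-(2 * ((d : ℝ) + 1)))

lemma weight_nonneg {s : ℝ} (hs : 0 ≤ s) : 0 ≤ weight d s := Real.rpow_nonneg (by linarith) _

lemma measurable_weight : Measurable (weight d) := by
  unfold weight
  fun_prop

lemma weight_le {r s t : ℝ} (hr : 0 ≤ r) (hs : 0 ≤ s) (ht : 0 ≤ t) (h : t ≤ s + 2 * r) :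
    weight d s ≤ (1 + 2 * r) ^ (2 * ((d : ℝ) + 1)) * weight d t := by
  unfold weight
  rw [Real.rpow_neg (by linarith), Real.rpow_neg (by linarith), ← div_eq_mul_inv,
    ← Real.div_rpow (by linarith) (by linarith), ← Real.inv_rpow (by linarith)]
  refine Real.rpow_le_rpow (by positivity) ?_ (by positivity)
  rw [le_div_iff₀ (by linarith), inv_mul_le_iff₀ (by linarith)]
  nlinarith

lemma lintegral_weight_ne_top :
    ∫⁻ z : Sp d, ENNReal.ofReal (weight d ‖z‖) ≠ ⊤ := by
  have h := integrable_one_add_norm (E := Sp d) (μ := volume) (r := 2 * ((d : ℝ) + 1))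
    (by rw [finrank_euclideanSpace_fin]; linarith [(Nat.cast_nonneg d : (0 : ℝ) ≤ d)])
  exact h.lintegral_lt_top.ne

/-- The exponent 2(d+1) exceeds 1 as well as d, so the weight is also integrable along the axis of a
tube. -/
lemma lintegral_weight_real_ne_top :
    ∫⁻ s : ℝ, ENNReal.ofReal (weight d ‖s‖) ≠ ⊤ := by
  have h := integrable_one_add_norm (E := ℝ) (μ := volume) (r := 2 * ((d : ℝ) + 1))
    (by rw [Module.finrank_self]; push_cast; linarith [(Nat.cast_nonneg d : (0 : ℝ) ≤ d)])
  exact h.lintegral_lt_top.ne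

/-- A point z of the tube lies in the ball of radius 2rε around sξ for every s within rε of z·ξ, an
interval of length 2rε, and the weights at z and sξ are comparable. This replaces adapted
coordinates by an average over balls. -/
lemma indicator_tube_mul_le {r ε : ℝ} (hr : 0 < r) (hε1 : ε ≤ 1) {ξ : Sp d}
    (hξ : ‖ξ‖ = 1) (z : Sp d) :
    ENNReal.ofReal (2 * (r * ε)) *
      (tube ξ (r * ε)).indicator (fun z => ENNReal.ofReal (weight d ‖z‖)) z ≤
    ∫⁻ s : ℝ, (Metric.closedBall (s • ξ) (2 * (r * ε))).indicator (fun _ =>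
      ENNReal.ofReal ((1 + 2 * r) ^ (2 * ((d : ℝ) + 1))) * ENNReal.ofReal (weight d ‖s‖)) z := by
  by_cases hz : z ∈ tube ξ (r * ε)
  swap
  · rw [Set.indicator_of_notMem hz]
    simp
  rw [Set.indicator_of_mem hz]
  set I := Set.Icc (inner ℝ z ξ - r * ε) (inner ℝ z ξ + r * ε) with hI
  have hvol : (volume : Measure ℝ) I = ENNReal.ofReal (2 * (r * ε)) := by
    rw [hI, Real.volume_Icc]
    congr 1
    ring
  have hrε : r * ε ≤ r := mul_le_of_le_one_right hr.le hε1
  have hpt : ∀ s, I.indicator (fun _ => ENNReal.ofReal (weight d ‖z‖)) s ≤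
      (Metric.closedBall (s • ξ) (2 * (r * ε))).indicator (fun _ =>
      ENNReal.ofReal ((1 + 2 * r) ^ (2 * ((d : ℝ) + 1))) * ENNReal.ofReal (weight d ‖s‖)) z := by
    intro s
    by_cases hs : s ∈ I
    swap
    · rw [Set.indicator_of_notMem hs]
      exact zero_le
    have hd : ‖z - s • ξ‖ ≤ 2 * (r * ε) := by
      have e : z - s • ξ = (z - (inner ℝ z ξ : ℝ) • ξ) + (inner ℝ z ξ - s) • ξ := by
        rw [sub_smul]; abel
      rw [e]
      refine (norm_add_le _ _).trans ?_
      rw [norm_smul, hξ, mul_one, Real.norm_eq_abs]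
      have h1 : |inner ℝ z ξ - s| ≤ r * ε := by
        rw [abs_le]
        constructor <;> linarith [hs.1, hs.2]
      have h2 : ‖z - (inner ℝ z ξ : ℝ) • ξ‖ ≤ r * ε := hz
      linarith
    rw [Set.indicator_of_mem hs, Set.indicator_of_mem (by rwa [Metric.mem_closedBall, dist_eq_norm]),
      ← ENNReal.ofReal_mul (by positivity)]
    refine ENNReal.ofReal_le_ofReal (weight_le hr.le (norm_nonneg _) (norm_nonneg _) ?_)
    have h3 : ‖s • ξ‖ ≤ ‖z‖ + ‖z - s • ξ‖ := by
      have := norm_sub_le z (z - s • ξ)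
      rwa [sub_sub_cancel] at this
    rw [norm_smul, hξ, mul_one] at h3
    linarith
  refine le_trans (le_of_eq ?_) (lintegral_mono hpt)
  rw [lintegral_indicator measurableSet_Icc, setLIntegral_const, hvol, mul_comm]

/-- The weighted volume of a tube of radius `rε` is `O(ε^{d-1})`. -/
lemma exists_lintegral_tube_le {r : ℝ} (hr : 0 < r) :
    ∃ C : ℝ, 0 ≤ C ∧ ∀ ε : ℝ, 0 < ε → ε ≤ 1 → ∀ ξ : Sp d, ‖ξ‖ = 1 →
      ∫⁻ z, (tube ξ (r * ε)).indicator (fun z => ENNReal.ofReal (weight d ‖z‖)) z ≤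
        ENNReal.ofReal (C * ε ^ ((d : ℝ) - 1)) := by
  set K := ENNReal.ofReal ((1 + 2 * r) ^ (2 * ((d : ℝ) + 1))) with hK
  set J := ∫⁻ s : ℝ, ENNReal.ofReal (weight d ‖s‖) with hJ
  set B := (volume : Measure (Sp d)) (Metric.closedBall 0 1) with hB
  have hBt : B ≠ ⊤ := (measure_closedBall_lt_top).ne
  have hJt : J ≠ ⊤ := lintegral_weight_real_ne_top
  refine ⟨(2 * r)⁻¹ * (K * J * B).toReal * (2 * r) ^ d, by positivity,
    fun ε hε hε1 ξ hξ => ?_⟩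
  have hrε : 0 < 2 * (r * ε) := by positivity
  have hmeasw : Measurable fun s : ℝ => K * ENNReal.ofReal (weight d ‖s‖) :=
    (measurable_weight.comp measurable_norm).ennreal_ofReal.const_mul _
  have hmeas : Measurable (Function.uncurry fun (z : Sp d) (s : ℝ) =>
      (Metric.closedBall (s • ξ) (2 * (r * ε))).indicator
        (fun _ => K * ENNReal.ofReal (weight d ‖s‖)) z) := by
    have hset : MeasurableSet {q : Sp d × ℝ | dist q.1 (q.2 • ξ) ≤ 2 * (r * ε)} :=
      (isClosed_le (by fun_prop) continuous_const).measurableSet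
    have := (hmeasw.comp (measurable_snd (α := Sp d))).indicator hset
    exact this
  have key : ENNReal.ofReal (2 * (r * ε)) *
      ∫⁻ z, (tube ξ (r * ε)).indicator (fun z => ENNReal.ofReal (weight d ‖z‖)) z ≤
      K * J * (ENNReal.ofReal ((2 * (r * ε)) ^ d) * B) := by
    rw [← lintegral_const_mul' _ _ ENNReal.ofReal_ne_top]
    refine (lintegral_mono fun z => indicator_tube_mul_le hr hε1 hξ z).trans ?_
    -- By Tonelli, each ball contributes a multiple of ε^d. Dividing by the factor 2rε then leaves
    -- ε^{d-1}.
    rw [lintegral_lintegral_swap hmeas.aemeasurable]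
    have hin : ∀ s : ℝ, ∫⁻ z : Sp d, (Metric.closedBall (s • ξ) (2 * (r * ε))).indicator
        (fun _ => K * ENNReal.ofReal (weight d ‖s‖)) z =
        K * ENNReal.ofReal (weight d ‖s‖) * (ENNReal.ofReal ((2 * (r * ε)) ^ d) * B) := by
      intro s
      rw [lintegral_indicator Metric.isClosed_closedBall.measurableSet, setLIntegral_const,
        Measure.addHaar_closedBall' _ _ hrε.le, finrank_euclideanSpace_fin]
    simp only [hin]
    rw [lintegral_mul_const _ hmeasw, lintegral_const_mul' _ _ ENNReal.ofReal_ne_top]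
  have hfin : K * J * B ≠ ⊤ := ENNReal.mul_ne_top (ENNReal.mul_ne_top ENNReal.ofReal_ne_top hJt) hBt
  have hpos : ENNReal.ofReal (2 * (r * ε)) ≠ 0 := by simpa using hrε
  have h2 := (ENNReal.le_div_iff_mul_le (Or.inl hpos) (Or.inl ENNReal.ofReal_ne_top)).2
    ((mul_comm _ _).trans_le key)
  refine h2.trans (le_of_eq ?_)
  have e1 : K * J * (ENNReal.ofReal ((2 * (r * ε)) ^ d) * B) =
      ENNReal.ofReal ((K * J * B).toReal * (2 * (r * ε)) ^ d) := by
    rw [ENNReal.ofReal_mul ENNReal.toReal_nonneg, ENNReal.ofReal_toReal hfin]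
    ring
  rw [e1, ← ENNReal.ofReal_div_of_pos hrε]
  congr 1
  rw [Real.rpow_sub_one hε.ne', Real.rpow_natCast, ← mul_assoc 2 r ε, mul_pow (2 * r)]
  field_simp

end TubeIntegral

/-! ### Sobolev norms of the profile. -/

section SobolevBounds

variable {d : ℕ}

/-- The `L^2` norms of the derivatives of the profile. -/
lemma exists_lintegral_profile_le {p : ℝ} (hp : 0 < p) (T : ℝ) {β : Sp d → ℝ}
    (hβ : ContDiff ℝ ∞ β) (hc : HasCompactSupport β) {H : ℝ → ℝ} (hH : ContDiff ℝ ∞ H)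
    (hHc : HasCompactSupport H) (a₀ : 𝓢(Sp d, ℂ)) (k : ℕ) :
    ∃ C : ℝ, 0 ≤ C ∧ ∀ ε : ℝ, 0 < ε → ε ≤ 1 → ∀ ξ : Sp d, ‖ξ‖ = 1 → ∀ τ : ℝ,
      ∫⁻ z, ‖iteratedFDeriv ℝ k (profile p T β H a₀ ε ξ τ) z‖ₑ ^ 2 ≤
        ENNReal.ofReal (C * (1 + ε ^ (2 * (2 * p - k + ((d : ℝ) - 1) / 2)))) := by
  obtain ⟨r₀, hr₀⟩ := hc.isCompact.isBounded.subset_closedBall 0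
  set r := max r₀ 1 with hrdef
  have hr0 : 0 < r := lt_max_of_lt_right one_pos
  have hr : tsupport β ⊆ Metric.closedBall 0 r :=
    hr₀.trans (Metric.closedBall_subset_closedBall (le_max_left _ _))
  -- The decay order d + 1 is chosen so that its square is the inverse of the weight.
  obtain ⟨A, hA0, hA⟩ := exists_bound_profile hp T hβ hc hH hHc a₀ hr (d + 1) k
  obtain ⟨B, hB0, hB⟩ := exists_lintegral_tube_le (d := d) hr0
  set W := (∫⁻ z : Sp d, ENNReal.ofReal (weight d ‖z‖)).toReal with hW
  have hWe : ∫⁻ z : Sp d, ENNReal.ofReal (weight d ‖z‖) = ENNReal.ofReal W :=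
    (ENNReal.ofReal_toReal lintegral_weight_ne_top).symm
  have hW0 : 0 ≤ W := ENNReal.toReal_nonneg
  refine ⟨2 * A ^ 2 * (W + B), by positivity, fun ε hε hε1 ξ hξ τ => ?_⟩
  set m := ε ^ (2 * p) * ε⁻¹ ^ k with hm
  have hm0 : 0 ≤ m := by positivity
  have hpt : ∀ z, ‖iteratedFDeriv ℝ k (profile p T β H a₀ ε ξ τ) z‖ₑ ^ 2 ≤
      ENNReal.ofReal (2 * A ^ 2) * (ENNReal.ofReal (weight d ‖z‖) + ENNReal.ofReal (m ^ 2) *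
        (tube ξ (r * ε)).indicator (fun z => ENNReal.ofReal (weight d ‖z‖)) z) := by
    intro z
    have h1 := hA ε hε hε1 ξ hξ τ z
    set I := (tube ξ (r * ε)).indicator (1 : Sp d → ℝ) z with hI
    have hI2 : I ^ 2 = I := by
      by_cases hz : z ∈ tube ξ (r * ε)
      · simp [hI, Set.indicator_of_mem hz]
      · simp [hI, Set.indicator_of_notMem hz]
    have hI0 : 0 ≤ I := by rw [← hI2]; positivity
    have hind : (tube ξ (r * ε)).indicator (fun z => ENNReal.ofReal (weight d ‖z‖)) z =
        ENNReal.ofReal (weight d ‖z‖ * I) := by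
      by_cases hz : z ∈ tube ξ (r * ε)
      · simp [hI, Set.indicator_of_mem hz]
      · simp [hI, Set.indicator_of_notMem hz]
    have hz1 : 0 < 1 + ‖z‖ := by positivity
    have hw : weight d ‖z‖ = (((1 + ‖z‖) ^ (d + 1)) ^ 2)⁻¹ := by
      rw [weight, Real.rpow_neg hz1.le, ← pow_mul, ← Real.rpow_natCast]
      congr 2
      push_cast
      ring
    have hw0 := weight_nonneg (d := d) (norm_nonneg z)
    rw [hind, ← ENNReal.ofReal_mul (by positivity),
      ← ENNReal.ofReal_add hw0 (by positivity), ← ENNReal.ofReal_mul (by positivity),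
      ← ofReal_norm, ← ENNReal.ofReal_pow (norm_nonneg _)]
    refine ENNReal.ofReal_le_ofReal ?_
    have h2 : ‖iteratedFDeriv ℝ k (profile p T β H a₀ ε ξ τ) z‖ ≤
        ((1 + ‖z‖) ^ (d + 1))⁻¹ * (A * (1 + m * I)) := by
      rw [le_inv_mul_iff₀ (by positivity)]
      exact h1
    calc ‖iteratedFDeriv ℝ k (profile p T β H a₀ ε ξ τ) z‖ ^ 2
        ≤ (((1 + ‖z‖) ^ (d + 1))⁻¹ * (A * (1 + m * I))) ^ 2 := by gcongr
      _ = weight d ‖z‖ * A ^ 2 * (1 + m * I) ^ 2 := by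
          rw [hw, mul_pow, mul_pow, inv_pow]; ring
      -- Uses I² = I for the indicator value.
      _ ≤ weight d ‖z‖ * A ^ 2 * (2 * (1 + m ^ 2 * I)) := by
          gcongr
          nlinarith [sq_nonneg (1 - m * I)]
      _ = _ := by ring
  refine (lintegral_mono hpt).trans ?_
  have hmw : Measurable fun z : Sp d => ENNReal.ofReal (weight d ‖z‖) :=
    (measurable_weight.comp measurable_norm).ennreal_ofReal
  rw [lintegral_const_mul' _ _ ENNReal.ofReal_ne_top, lintegral_add_left hmw,
    lintegral_const_mul' _ _ ENNReal.ofReal_ne_top, hWe]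
  calc _ ≤ ENNReal.ofReal (2 * A ^ 2) * (ENNReal.ofReal W + ENNReal.ofReal (m ^ 2) *
        ENNReal.ofReal (B * ε ^ ((d : ℝ) - 1))) := by
        gcongr
        exact hB ε hε hε1 ξ hξ
    _ = ENNReal.ofReal (2 * A ^ 2 * (W + m ^ 2 * (B * ε ^ ((d : ℝ) - 1)))) := by
        rw [ENNReal.ofReal_mul (by positivity : 0 ≤ 2 * A ^ 2),
          ENNReal.ofReal_add hW0 (by positivity),
          ENNReal.ofReal_mul (by positivity : 0 ≤ m ^ 2)]
    _ ≤ _ := by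
        refine ENNReal.ofReal_le_ofReal ?_
        have e : m ^ 2 * ε ^ ((d : ℝ) - 1) = ε ^ (2 * (2 * p - k + ((d : ℝ) - 1) / 2)) := by
          have e1 : 2 * (2 * p - k + ((d : ℝ) - 1) / 2) =
              (2 * p - k) * (2 : ℕ) + ((d : ℝ) - 1) := by push_cast; ring
          have e2 : m = ε ^ (2 * p - k) := by
            rw [Real.rpow_sub hε, Real.rpow_natCast, hm, inv_pow, div_eq_mul_inv]
          rw [e1, Real.rpow_add hε, Real.rpow_mul hε.le, Real.rpow_natCast, e2]
        have e2 : m ^ 2 * (B * ε ^ ((d : ℝ) - 1)) =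
            B * ε ^ (2 * (2 * p - k + ((d : ℝ) - 1) / 2)) := by rw [← e]; ring
        rw [e2, mul_assoc (2 * A ^ 2)]
        have h3 : 0 ≤ ε ^ (2 * (2 * p - k + ((d : ℝ) - 1) / 2)) := by positivity
        gcongr
        nlinarith [mul_nonneg hW0 h3]

/-- The profile is a Schwartz function. -/
lemma exists_schwartz_profile {p : ℝ} (hp : 0 < p) (T : ℝ) {β : Sp d → ℝ}
    (hβ : ContDiff ℝ ∞ β) (hc : HasCompactSupport β) {H : ℝ → ℝ} (hH : ContDiff ℝ ∞ H)
    (hHc : HasCompactSupport H) (a₀ : 𝓢(Sp d, ℂ)) {ε : ℝ} (hε : 0 < ε) (hε1 : ε ≤ 1) {ξ : Sp d}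
    (hξ : ‖ξ‖ = 1) (τ : ℝ) (v : Sp d) :
    ∃ F : 𝓢(Sp d, ℂ), ⇑F = fun x => profile p T β H a₀ ε ξ τ (x + v) := by
  obtain ⟨r, hr⟩ := hc.isCompact.isBounded.subset_closedBall 0
  have hQs : ContDiff ℝ ∞ (corrector p T β H a₀ ε ξ τ) :=
    (unifSmooth_corrector hp T hβ hc hH hHc a₀).1 ⟨(ε, ξ, τ), hε, hε1, hξ⟩
  have hsm : ContDiff ℝ ∞ (profile p T β H a₀ ε ξ τ) :=
    (a₀.smooth ⊤).add (((a₀.smooth ⊤).mul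
      (hQs.comp (contDiff_const_smul ε⁻¹))).const_smul (ε ^ (2 * p)))
  let P : 𝓢(Sp d, ℂ) :=
    { toFun := profile p T β H a₀ ε ξ τ
      smooth' := hsm
      decay' := by
        intro N k
        obtain ⟨C, hC0, hC⟩ := exists_bound_profile hp T hβ hc hH hHc a₀ hr N k
        refine ⟨C * (1 + ε ^ (2 * p) * ε⁻¹ ^ k * 1), fun x => ?_⟩
        have h1 : (tube ξ (r * ε)).indicator (1 : Sp d → ℝ) x ≤ 1 :=
          Set.indicator_le_self' (fun _ _ => zero_le_one) x
        calc ‖x‖ ^ N * ‖iteratedFDeriv ℝ k (profile p T β H a₀ ε ξ τ) x‖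
            ≤ (1 + ‖x‖) ^ N * ‖iteratedFDeriv ℝ k (profile p T β H a₀ ε ξ τ) x‖ := by
              gcongr
              linarith
          _ ≤ _ := hC ε hε hε1 ξ hξ τ x
          _ ≤ _ := by gcongr }
  refine ⟨P.compSubConstCLM ℝ (-v), ?_⟩
  ext x
  rw [SchwartzMap.compSubConstCLM_apply, sub_neg_eq_add]
  rfl

/-- Sobolev bounds for the profile, of integer order. -/
lemma exists_normH_profile_le {p : ℝ} (hp : 0 < p) (T : ℝ) {β : Sp d → ℝ}
    (hβ : ContDiff ℝ ∞ β) (hc : HasCompactSupport β) {H : ℝ → ℝ} (hH : ContDiff ℝ ∞ H)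
    (hHc : HasCompactSupport H) (a₀ : 𝓢(Sp d, ℂ)) (k : ℕ) :
    ∃ C : ℝ, 0 < C ∧ ∀ ε : ℝ, 0 < ε → ε ≤ 1 → ∀ ξ : Sp d, ‖ξ‖ = 1 → ∀ (τ : ℝ) (v : Sp d),
      normH k (fun x => profile p T β H a₀ ε ξ τ (x + v)) ≤
        ENNReal.ofReal (C * max 1 (ε ^ (2 * p - k + ((d : ℝ) - 1) / 2))) := by
  obtain ⟨C₀, hC₀, h₀⟩ := exists_lintegral_profile_le hp T hβ hc hH hHc a₀ 0
  obtain ⟨C₁, hC₁, h₁⟩ := exists_lintegral_profile_le hp T hβ hc hH hHc a₀ k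
  set D : ℝ := 2 ^ k * (1 + (d : ℝ) ^ k * d) with hD
  have hD0 : 0 < D := by positivity
  -- The summand 1 only makes the constant positive.
  refine ⟨Real.sqrt (D * (2 * (C₀ + C₁)) + 1), Real.sqrt_pos.2 (by positivity),
    fun ε hε hε1 ξ hξ τ v => ?_⟩
  obtain ⟨F, hF⟩ := exists_schwartz_profile hp T hβ hc hH hHc a₀ hε hε1 hξ τ v
  rw [← hF]
  refine (normH_natCast_le k F).trans ?_
  set e := 2 * p - k + ((d : ℝ) - 1) / 2 with he
  set m := max 1 (ε ^ e) with hm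
  have hm1 : 1 ≤ m := le_max_left _ _
  have hem : ε ^ (2 * e) ≤ m ^ 2 := by
    rw [mul_comm, Real.rpow_mul hε.le, Real.rpow_two]
    exact pow_le_pow_left₀ (by positivity) (le_max_right _ _) 2
  have hL : ∀ j : ℕ, ∫⁻ x, ‖iteratedFDeriv ℝ j F x‖ₑ ^ 2 =
      ∫⁻ z, ‖iteratedFDeriv ℝ j (profile p T β H a₀ ε ξ τ) z‖ₑ ^ 2 := by
    intro j
    rw [hF]
    simp only [iteratedFDeriv_comp_add_right]
    exact lintegral_add_right_eq_self
      (fun z => ‖iteratedFDeriv ℝ j (profile p T β H a₀ ε ξ τ) z‖ₑ ^ 2) v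
  have hF0 : ∫⁻ x, ‖F x‖ₑ ^ 2 ≤ ENNReal.ofReal (C₀ * (2 * m ^ 2)) := by
    have e0 : ∀ x, ‖F x‖ₑ = ‖iteratedFDeriv ℝ 0 F x‖ₑ := fun x => by
      rw [← ofReal_norm, ← ofReal_norm, norm_iteratedFDeriv_zero]
    simp only [e0]
    rw [hL]
    refine (h₀ ε hε hε1 ξ hξ τ).trans (ENNReal.ofReal_le_ofReal ?_)
    -- As ε ≤ 1, the bound of order 0 is absorbed in the one of order k.
    have hle : ε ^ (2 * (2 * p - (0 : ℕ) + ((d : ℝ) - 1) / 2)) ≤ ε ^ (2 * e) := by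
      refine Real.rpow_le_rpow_of_exponent_ge hε hε1 ?_
      have : (0 : ℝ) ≤ k := Nat.cast_nonneg k
      rw [he]
      push_cast
      linarith
    gcongr
    nlinarith
  have hFk : ∫⁻ x, ‖iteratedFDeriv ℝ k F x‖ₑ ^ 2 ≤ ENNReal.ofReal (C₁ * (2 * m ^ 2)) := by
    rw [hL]
    refine (h₁ ε hε hε1 ξ hξ τ).trans (ENNReal.ofReal_le_ofReal ?_)
    gcongr
    nlinarith
  calc _ ≤ (ENNReal.ofReal D * (ENNReal.ofReal (C₀ * (2 * m ^ 2)) +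
        ENNReal.ofReal (C₁ * (2 * m ^ 2)))) ^ (1 / 2 : ℝ) := by gcongr
    _ = ENNReal.ofReal (Real.sqrt (D * (C₀ * (2 * m ^ 2) + C₁ * (2 * m ^ 2)))) := by
        rw [← ENNReal.ofReal_add (by positivity) (by positivity), ← ENNReal.ofReal_mul hD0.le,
          ENNReal.ofReal_rpow_of_nonneg (by positivity) (by norm_num), Real.sqrt_eq_rpow]
    _ ≤ _ := by
        refine ENNReal.ofReal_le_ofReal ?_
        have hm0 : 0 ≤ m := by linarith
        rw [← Real.sqrt_sq hm0, ← Real.sqrt_mul (by positivity), Real.sqrt_sq hm0]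
        refine Real.sqrt_le_sqrt ?_
        nlinarith [sq_nonneg m]

end SobolevBounds

/-! ### Expansion of the residual of a wave packet. -/

section Residual

variable {d : ℕ}

lemma sum_mul_pderiv (f : Sp d → ℂ) (x ξ : Sp d) :
    ∑ i, (ξ i : ℂ) * pderiv i f x = fderiv ℝ f x ξ := by
  have h : ξ = ∑ i, ξ i • (EuclideanSpace.single i (1 : ℝ) : Sp d) := by
    have := (EuclideanSpace.basisFun (Fin d) ℝ).sum_repr ξ
    simpa using this.symm
  conv_rhs => rw [h]
  rw [map_sum]
  refine Finset.sum_congr rfl fun i _ => ?_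
  rw [map_smul, Complex.real_smul]
  rfl

lemma norm_planeWave (n : ℕ) (ξ : Sp d) (t : ℝ) (x : Sp d) : ‖planeWave n ξ t x‖ = 1 := by
  rw [planeWave, mul_comm, Complex.norm_exp_ofReal_mul_I]

lemma hasDerivAt_planeWave (n : ℕ) (ξ : Sp d) (t : ℝ) (x : Sp d) :
    HasDerivAt (fun s => planeWave n ξ s x)
      (planeWave n ξ t x * (Complex.I * (1 / (2 * (n : ℂ))))) t := by
  have h1 : HasDerivAt (fun s : ℝ => ((inner ℝ x ξ + s / (2 * (n : ℝ)) : ℝ) : ℂ))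
      (((1 / (2 * (n : ℝ)) : ℝ)) : ℂ) t :=
    (((hasDerivAt_id t).div_const (2 * (n : ℝ))).const_add (inner ℝ x ξ)).ofReal_comp
  have h2 := (h1.const_mul Complex.I).cexp
  push_cast at h2
  refine HasDerivAt.congr_deriv (f := fun s => planeWave n ξ s x) ?_ rfl
  unfold planeWave
  push_cast
  exact h2

/-- The expansion of the residual of a wave packet with smooth amplitude. -/
lemma residual_packet {n : ℕ} (hn : 1 ≤ n) {p T ε : ℝ} (hε : 0 < ε) {ξ : Sp d} (hξ : ‖ξ‖ = 1)
    (β : Sp d → ℝ) (G : ℝ → ℝ) {a : ℝ → Sp d → ℂ}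
    (ha : ContDiff ℝ ∞ fun z : ℝ × Sp d => a z.1 z.2) (t : ℝ) (x : Sp d) :
    residual n β G (packet n p T ε ξ a) t x =
      ((ε ^ (p + 2 * (n : ℝ)) : ℝ) : ℂ) * planeWave n ξ t x *
        transportTerm n p ε ξ G a (β x) (ε ^ (2 * (n : ℝ)) * (t + T)) (ε • (x + T • ξ))
      + ((ε ^ (p + 2 * (n : ℝ)) : ℝ) : ℂ) * planeWave n ξ t x *
        ∑ j ∈ Finset.Icc 2 (2 * n), ((ε ^ ((j : ℝ) - 2 * (n : ℝ)) : ℝ) : ℂ) *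
          ∑ α ∈ multiIndices d j, errorCoeff n ξ α *
            mderiv α (a (ε ^ (2 * (n : ℝ)) * (t + T))) (ε • (x + T • ξ)) := by
  set E := ε ^ (2 * (n : ℝ)) with hE
  have hE0 : 0 < E := Real.rpow_pos_of_pos hε _
  have hEc : (E : ℂ) ≠ 0 := by exact_mod_cast hE0.ne'
  set X := ε • (x + T • ξ) with hX
  set t' := E * (t + T) with ht'
  have hat : ContDiff ℝ ∞ (a t') := ha.comp (contDiff_const.prodMk contDiff_id)
  have haX : ContDiff ℝ ∞ fun s => a s X := ha.comp (contDiff_id.prodMk contDiff_const)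
  have hda : HasDerivAt (fun s => a s X) (deriv (fun s => a s X) t') t' :=
    ((haX.differentiable (by simp)) t').hasDerivAt
  have haff : HasDerivAt (fun s : ℝ => E * (s + T)) E t := by
    simpa using ((hasDerivAt_id t).add_const T).const_mul E
  have hcomp : HasDerivAt (fun s => a (E * (s + T)) X)
      (E • deriv (fun s => a s X) t') t :=
    HasDerivAt.scomp (g₁ := fun s => a s X) t hda haff
  have hv : HasDerivAt (fun s => packet n p T ε ξ a s x) _ t :=
    (hcomp.const_mul ((ε ^ p : ℝ) : ℂ)).mul (hasDerivAt_planeWave n ξ t x)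
  have hlap := negLaplacianPow_packet n hn hξ t hat ((ε ^ p : ℝ) : ℂ) ε (T • ξ) x
  have hnorm : ‖packet n p T ε ξ a t x‖ ^ 2 = ε ^ (2 * p) * ‖a t' X‖ ^ 2 := by
    have e : ε ^ (2 * p) = (ε ^ p) ^ 2 := by rw [mul_comm, Real.rpow_mul hε.le, Real.rpow_two]
    rw [e, packet, norm_mul, norm_mul, norm_planeWave, mul_one, Complex.norm_real,
      Real.norm_of_nonneg (by positivity), mul_pow]
  rw [residual, hnorm, hv.deriv]
  have hpk : packet n p T ε ξ a t = fun x => ((ε ^ p : ℝ) : ℂ) * a t' (ε • (x + T • ξ)) *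
      planeWave n ξ t x := rfl
  rw [hpk, hlap]
  have hr1 : ε ^ (p + 2 * (n : ℝ)) = ε ^ p * E := Real.rpow_add hε _ _
  have hr2 : ε ^ (1 - 2 * (n : ℝ)) = ε / E := by rw [Real.rpow_sub hε, Real.rpow_one]
  have hr3 : ε ^ (-(2 * (n : ℝ))) = E⁻¹ := Real.rpow_neg hε.le _
  have hr4 : ∀ j : ℕ, ε ^ ((j : ℝ) - 2 * (n : ℝ)) = ε ^ j / E := fun j => by
    rw [Real.rpow_sub hε, Real.rpow_natCast]
  simp only [transportTerm, hr1, hr2, hr3, hr4]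
  have hsum : ∑ j ∈ Finset.Icc 2 (2 * n), ((ε ^ j / E : ℝ) : ℂ) * ∑ α ∈ multiIndices d j,
      errorCoeff n ξ α * mderiv α (a t') X = (E : ℂ)⁻¹ * ∑ j ∈ Finset.Icc 2 (2 * n),
        (ε : ℂ) ^ j * ∑ α ∈ multiIndices d j, errorCoeff n ξ α * mderiv α (a t') X := by
    rw [Finset.mul_sum]
    refine Finset.sum_congr rfl fun j _ => ?_
    push_cast
    ring
  rw [hsum, Complex.real_smul]
  rw [← hX]
  generalize (∑ j ∈ Finset.Icc 2 (2 * n), (ε : ℂ) ^ j * ∑ α ∈ multiIndices d j,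
    errorCoeff n ξ α * mderiv α (a t') X) = S
  generalize (∑ k, (ξ k : ℂ) * pderiv k (a t') X) = D
  have hn0 : (n : ℂ) ≠ 0 := by exact_mod_cast (by omega : n ≠ 0)
  push_cast
  field_simp
  -- With i² = -1, the term i·i/(2n) from the time derivative of the plane wave cancels the 1/(2n)
  -- of degree zero.
  linear_combination (((ε ^ p : ℝ) : ℂ) * a t' X * planeWave n ξ t x) * Complex.I_sq

end Residual

/-! ### The amplitude as a translated profile, and its transport equation. -/

section Amplitude

variable {d : ℕ}

/-- The value `G(ε^{2p}|a₀(z)|^2)`, expressed by the smooth function `H(r) = G(r)/r`. -/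
def phaseCoeff (p : ℝ) (H : ℝ → ℝ) (a₀ : Sp d → ℂ) (ε : ℝ) (z : Sp d) : ℝ :=
  ε ^ (2 * p) * ‖a₀ z‖ ^ 2 * H (ε ^ (2 * p) * ‖a₀ z‖ ^ 2)

lemma contDiff_phaseCoeff (p : ℝ) {H : ℝ → ℝ} (hH : ContDiff ℝ ∞ H) (a₀ : 𝓢(Sp d, ℂ)) (ε : ℝ) :
    ContDiff ℝ ∞ (phaseCoeff p H a₀ ε) := by
  have h : ContDiff ℝ ∞ fun z => ε ^ (2 * p) * ‖a₀ z‖ ^ 2 :=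
    contDiff_const.mul ((a₀.smooth ⊤).norm_sq ℝ)
  exact h.mul (hH.comp h)

lemma inv_smul_add {n : ℕ} {ε : ℝ} (hε : 0 < ε) (t : ℝ) (ξ x : Sp d) :
    ε⁻¹ • (x + (ε ^ (1 - 2 * (n : ℝ)) * t) • ξ) =
      ε⁻¹ • x + (ε ^ (-(2 * (n : ℝ))) * t) • ξ := by
  rw [smul_add, smul_smul, ← mul_assoc]
  congr 3
  rw [sub_eq_add_neg, Real.rpow_add hε, Real.rpow_one, inv_mul_cancel_left₀ hε.ne']

/-- The time integral in the phase of the amplitude. -/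
lemma mul_integral_phase {n : ℕ} {T ε : ℝ} (hε : 0 < ε) {β : Sp d → ℝ} (hβ : Continuous β)
    (hc : HasCompactSupport β) {ξ : Sp d} (hξ : ‖ξ‖ = 1) (t : ℝ) (x : Sp d) :
    ε ^ (-(2 * (n : ℝ))) *
      ∫ s in (0 : ℝ)..t, β (ε⁻¹ • x + (ε ^ (-(2 * (n : ℝ))) * (t - s)) • ξ - T • ξ) =
    rayPrim ξ β (ε⁻¹ • (x + (ε ^ (1 - 2 * (n : ℝ)) * t) • ξ) - T • ξ) -
      rayPrim ξ β (ε⁻¹ • x - T • ξ) := by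
  set c := ε ^ (-(2 * (n : ℝ))) with hcdef
  have h1 := intervalIntegral.integral_comp_sub_left (a := 0) (b := t)
    (fun s => β (ε⁻¹ • x + (c * s) • ξ - T • ξ)) t
  have h2 := intervalIntegral.mul_integral_comp_mul_left (a := 0) (b := t)
    (f := fun s => β (ε⁻¹ • x + s • ξ - T • ξ)) c
  rw [sub_self, sub_zero] at h1
  rw [mul_zero] at h2
  rw [h1, h2]
  have h3 := rayPrim_add_sub hξ hβ hc (ε⁻¹ • x - T • ξ) (c * t)
  rw [inv_smul_add hε, ← hcdef, add_sub_right_comm, h3]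
  simp only [add_sub_right_comm]

variable {n : ℕ} {p T ε R : ℝ} {β : Sp d → ℝ} {G H : ℝ → ℝ} {a₀ : 𝓢(Sp d, ℂ)} {ξ : Sp d}

lemma amplitude_eq (hβ : Continuous β) (hc : HasCompactSupport β)
    (hGH : ∀ r, 0 ≤ r → r ≤ R → G r = r * H r) (hε : 0 < ε)
    (hsmall : ∀ z, ε ^ (2 * p) * ‖a₀ z‖ ^ 2 ≤ R) (hξ : ‖ξ‖ = 1) (t : ℝ) (x : Sp d) :
    amplitude n p T β G a₀ ε ξ t x = a₀ (x + (ε ^ (1 - 2 * (n : ℝ)) * t) • ξ) *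
      Complex.exp (-Complex.I * ((phaseCoeff p H a₀ ε (x + (ε ^ (1 - 2 * (n : ℝ)) * t) • ξ) *
        (rayPrim ξ β (ε⁻¹ • (x + (ε ^ (1 - 2 * (n : ℝ)) * t) • ξ) - T • ξ) -
          rayPrim ξ β (ε⁻¹ • x - T • ξ)) : ℝ) : ℂ)) := by
  rw [amplitude, mul_right_comm (ε ^ (-(2 * (n : ℝ)))), mul_integral_phase hε hβ hc hξ,
    hGH _ (by positivity) (hsmall _), phaseCoeff, mul_comm (rayPrim _ _ _ - _)]

/-- Time enters only through a translation, invisible to the norms, and through τ, in which the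
profile bounds are uniform. -/
lemma amplitude_eq_profile (hβ : Continuous β) (hc : HasCompactSupport β)
    (hGH : ∀ r, 0 ≤ r → r ≤ R → G r = r * H r) (hε : 0 < ε)
    (hsmall : ∀ z, ε ^ (2 * p) * ‖a₀ z‖ ^ 2 ≤ R) (hξ : ‖ξ‖ = 1) (t : ℝ) :
    amplitude n p T β G a₀ ε ξ t = fun x => profile p T β H a₀ ε ξ (ε ^ (-(2 * (n : ℝ))) * t)
      (x + (ε ^ (1 - 2 * (n : ℝ)) * t) • ξ) := by
  ext x
  have hρ : ε ^ (2 * p) ≠ 0 := (Real.rpow_pos_of_pos hε _).ne'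
  rw [amplitude_eq hβ hc hGH hε hsmall hξ, profile]
  set z := x + (ε ^ (1 - 2 * (n : ℝ)) * t) • ξ with hz
  have hray : rayIntegral T β ξ (ε ^ (-(2 * (n : ℝ))) * t) (ε⁻¹ • z) =
      rayPrim ξ β (ε⁻¹ • z - T • ξ) - rayPrim ξ β (ε⁻¹ • x - T • ξ) := by
    rw [rayIntegral]
    congr 2
    rw [hz, inv_smul_add hε]
    abel
  rw [corrector, hray, smul_inv_smul₀ hε.ne']
  set Δ := rayPrim ξ β (ε⁻¹ • z - T • ξ) - rayPrim ξ β (ε⁻¹ • x - T • ξ) with hΔ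
  have e : phaseCoeff p H a₀ ε z * Δ =
      ε ^ (2 * p) * (‖a₀ z‖ ^ 2 * H (ε ^ (2 * p) * ‖a₀ z‖ ^ 2) * Δ) := by
    rw [phaseCoeff]; ring
  rw [e, exp_eq_one_add_expQuot hρ, Complex.real_smul]
  ring

/-- With ray primitives in place of the time integral, joint smoothness in (t, x) is a matter of
composition. -/
lemma contDiff_amplitude (hβ : ContDiff ℝ ∞ β) (hc : HasCompactSupport β) (hH : ContDiff ℝ ∞ H)
    (hGH : ∀ r, 0 ≤ r → r ≤ R → G r = r * H r) (hε : 0 < ε)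
    (hsmall : ∀ z, ε ^ (2 * p) * ‖a₀ z‖ ^ 2 ≤ R) (hξ : ‖ξ‖ = 1) :
    ContDiff ℝ ∞ fun w : ℝ × Sp d => amplitude n p T β G a₀ ε ξ w.1 w.2 := by
  simp only [amplitude_eq hβ.continuous hc hGH hε hsmall hξ]
  have hz : ContDiff ℝ ∞ fun w : ℝ × Sp d => w.2 + (ε ^ (1 - 2 * (n : ℝ)) * w.1) • ξ := by
    fun_prop
  have hP := contDiff_rayPrim hξ hβ hc
  have h1 := (contDiff_phaseCoeff p hH a₀ ε).comp hz
  have h2 : ContDiff ℝ ∞ fun w : ℝ × Sp d =>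
      rayPrim ξ β (ε⁻¹ • (w.2 + (ε ^ (1 - 2 * (n : ℝ)) * w.1) • ξ) - T • ξ) :=
    hP.comp ((hz.const_smul ε⁻¹).sub contDiff_const)
  have h3 : ContDiff ℝ ∞ fun w : ℝ × Sp d => rayPrim ξ β (ε⁻¹ • w.2 - T • ξ) :=
    hP.comp ((contDiff_snd.const_smul ε⁻¹).sub contDiff_const)
  have h4 := Complex.ofRealCLM.contDiff.comp (h1.mul (h2.sub h3))
  exact ((a₀.smooth ⊤).comp hz).mul (contDiff_const.mul h4).cexp

lemma norm_amplitude (t : ℝ) (x : Sp d) :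
    ‖amplitude n p T β G a₀ ε ξ t x‖ = ‖a₀ (x + (ε ^ (1 - 2 * (n : ℝ)) * t) • ξ)‖ := by
  have e : ∀ r : ℝ, -Complex.I * (r : ℂ) = ((-r : ℝ) : ℂ) * Complex.I := fun r => by
    push_cast; ring
  rw [amplitude, norm_mul, e, Complex.norm_exp_ofReal_mul_I, mul_one]

/-- The transport equation for the amplitude. -/
lemma transportTerm_amplitude (hβ : ContDiff ℝ ∞ β) (hc : HasCompactSupport β)
    (hH : ContDiff ℝ ∞ H) (hGH : ∀ r, 0 ≤ r → r ≤ R → G r = r * H r) (hε : 0 < ε)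
    (hsmall : ∀ z, ε ^ (2 * p) * ‖a₀ z‖ ^ 2 ≤ R) (hξ : ‖ξ‖ = 1) (t : ℝ) (x : Sp d) :
    transportTerm n p ε ξ G (amplitude n p T β G a₀ ε ξ) (β (ε⁻¹ • x - T • ξ)) t x = 0 := by
  set a := amplitude n p T β G a₀ ε ξ with hadef
  have ha : ContDiff ℝ ∞ fun w : ℝ × Sp d => a w.1 w.2 :=
    contDiff_amplitude hβ hc hH hGH hε hsmall hξ
  have hat : ContDiff ℝ ∞ (a t) := ha.comp (contDiff_const.prodMk contDiff_id)
  have hax : ContDiff ℝ ∞ fun s => a s x := ha.comp (contDiff_id.prodMk contDiff_const)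
  set c := ε ^ (1 - 2 * (n : ℝ)) with hcdef
  have hcε : ε⁻¹ * c = ε ^ (-(2 * (n : ℝ))) := by
    rw [hcdef, sub_eq_add_neg, Real.rpow_add hε, Real.rpow_one, inv_mul_cancel_left₀ hε.ne']
  set Y := ε⁻¹ • x - T • ξ with hY
  set g := fun s : ℝ => phaseCoeff p H a₀ ε (x + (c * (t + s)) • ξ) with hg
  set Δ := fun s : ℝ => ∫ u in (0 : ℝ)..(ε⁻¹ * c) * s, β (Y + u • ξ) with hΔ
  -- Both amplitudes see a₀ at the same point x + c(t+s)ξ, so they differ only by the phase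
  -- accumulated over a segment. Differentiating at s = 0 yields the equation.
  have hrel : ∀ s : ℝ, a t (x + (c * s) • ξ) =
      a (t + s) x * Complex.exp (Complex.I * ((g s * Δ s : ℝ) : ℂ)) := by
    intro s
    rw [hadef, amplitude_eq hβ.continuous hc hGH hε hsmall hξ,
      amplitude_eq hβ.continuous hc hGH hε hsmall hξ, mul_assoc, ← Complex.exp_add, ← hcdef]
    have e1 : x + (c * s) • ξ + (c * t) • ξ = x + (c * (t + s)) • ξ := by module
    have e2 : ε⁻¹ • (x + (c * s) • ξ) - T • ξ = Y + (ε⁻¹ * c * s) • ξ := by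
      rw [hY]; module
    have e3 := rayPrim_add_sub hξ hβ.continuous hc Y (ε⁻¹ * c * s)
    have e4 : Δ s = rayPrim ξ β (Y + (ε⁻¹ * c * s) • ξ) - rayPrim ξ β Y := e3.symm
    rw [e1, e2, ← hY, e4]
    congr 2
    push_cast
    ring
  have hg1 : DifferentiableAt ℝ g 0 := by
    refine DifferentiableAt.comp (0 : ℝ)
      (((contDiff_phaseCoeff p hH a₀ ε).differentiable (by simp)) _) ?_
    fun_prop
  have hΔ1 : HasDerivAt Δ ((ε⁻¹ * c) * β Y) 0 := by
    have hcont : Continuous fun u : ℝ => β (Y + u • ξ) := by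
      have := hβ.continuous
      fun_prop
    have h1 : HasDerivAt (fun v => ∫ u in (0 : ℝ)..v, β (Y + u • ξ)) (β (Y + (0 : ℝ) • ξ))
        ((ε⁻¹ * c) * 0) := by
      rw [mul_zero]
      exact intervalIntegral.integral_hasDerivAt_right (hcont.intervalIntegrable _ _)
        (hcont.stronglyMeasurableAtFilter _ _) hcont.continuousAt
    have h2 : HasDerivAt (fun s : ℝ => (ε⁻¹ * c) * s) (ε⁻¹ * c) 0 := by
      simpa using (hasDerivAt_id (0 : ℝ)).const_mul (ε⁻¹ * c)
    refine (h1.comp 0 h2).congr_deriv ?_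
    rw [zero_smul, add_zero, mul_comm]
  -- Removes the derivative of the phase coefficient g from the product rule.
  have hΔ0 : Δ 0 = 0 := by simp [hΔ]
  have hprod : HasDerivAt (fun s => g s * Δ s) (g 0 * ((ε⁻¹ * c) * β Y)) 0 := by
    refine (hg1.hasDerivAt.mul hΔ1).congr_deriv ?_
    rw [hΔ0, mul_zero, zero_add]
  have hexp := (hprod.ofReal_comp.const_mul Complex.I).cexp
  rw [hΔ0, mul_zero, Complex.ofReal_zero, mul_zero, Complex.exp_zero, one_mul] at hexp
  have hshift : HasDerivAt (fun s => a (t + s) x) (deriv (fun s => a s x) t) 0 := by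
    have h1 : HasDerivAt (fun s => a s x) (deriv (fun s => a s x) t) (t + 0) := by
      rw [add_zero]
      exact ((hax.differentiable (by simp)) t).hasDerivAt
    exact h1.comp_const_add t 0
  have hleft : HasDerivAt (fun s : ℝ => a t (x + (c * s) • ξ)) (c • fderiv ℝ (a t) x ξ) 0 := by
    have h1 : HasFDerivAt (a t) (fderiv ℝ (a t) x) (x + (c * (0 : ℝ)) • ξ) := by
      rw [mul_zero, zero_smul, add_zero]
      exact ((hat.differentiable (by simp)) x).hasFDerivAt
    have h2 : HasDerivAt (fun s : ℝ => x + (c * s) • ξ) (c • ξ) 0 := by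
      have h3 : HasDerivAt (fun s : ℝ => c * s) c 0 := by
        simpa using (hasDerivAt_id (0 : ℝ)).const_mul c
      exact (h3.smul_const ξ).const_add x
    refine (h1.comp_hasDerivAt 0 h2).congr_deriv ?_
    rw [map_smul]
  have hright := hshift.mul hexp
  have heq : c • fderiv ℝ (a t) x ξ = deriv (fun s => a s x) t +
      a t x * (Complex.I * ((g 0 * (ε⁻¹ * c * β Y) : ℝ) : ℂ)) := by
    have hfun : (fun s : ℝ => a t (x + (c * s) • ξ)) = (fun s => a (t + s) x) *
        fun s => Complex.exp (Complex.I * ((g s * Δ s : ℝ) : ℂ)) := funext hrel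
    rw [hfun] at hleft
    rw [hleft.unique hright, hΔ0]
    simp
  have hG : G (ε ^ (2 * p) * ‖a t x‖ ^ 2) = g 0 := by
    rw [hadef, norm_amplitude, hGH _ (by positivity) (hsmall _), hg]
    simp only [add_zero, phaseCoeff, hcdef]
  rw [Complex.real_smul] at heq
  rw [transportTerm, sum_mul_pderiv, ← hcdef, mul_assoc Complex.I, heq, hG, ← hcε]
  push_cast
  linear_combination (-(a t x * g 0 * ε⁻¹ * c * β Y)) * Complex.I_sq

end Amplitude

/-! ### Choice of the threshold, and bookkeeping of constants. -/

variable {d : ℕ}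

/-- Below a threshold, the nonlinearity is only evaluated near the origin. -/
lemma exists_threshold {p r : ℝ} (hp : 0 < p) (hr : 0 < r) (a₀ : 𝓢(Sp d, ℂ)) :
    ∃ ε₀ : ℝ, 0 < ε₀ ∧ ε₀ ≤ 1 ∧
      ∀ ε, 0 < ε → ε < ε₀ → ∀ z, ε ^ (2 * p) * ‖a₀ z‖ ^ 2 ≤ r := by
  set M := SchwartzMap.seminorm ℝ 0 0 a₀ with hM
  have hM0 : 0 ≤ M := apply_nonneg _ _
  have hq : 0 < r / (M ^ 2 + 1) := by positivity
  -- The power solves ε^{2p} = r/(M² + 1), the 1 guarding against M = 0; the minimum with 1 lets all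
  -- bounds for ε ≤ 1 apply.
  refine ⟨min 1 ((r / (M ^ 2 + 1)) ^ (1 / (2 * p))),
    lt_min one_pos (Real.rpow_pos_of_pos hq _), min_le_left _ _, fun ε hε hlt z => ?_⟩
  have h1 : ε ^ (2 * p) ≤ r / (M ^ 2 + 1) := by
    have h := Real.rpow_le_rpow hε.le (hlt.le.trans (min_le_right _ _))
      (by positivity : 0 ≤ 2 * p)
    rwa [← Real.rpow_mul hq.le, one_div_mul_cancel (by positivity), Real.rpow_one] at h
  have h2 : ‖a₀ z‖ ^ 2 ≤ M ^ 2 + 1 := by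
    have := pow_le_pow_left₀ (norm_nonneg _) (SchwartzMap.norm_le_seminorm ℝ a₀ z) 2
    linarith
  calc ε ^ (2 * p) * ‖a₀ z‖ ^ 2 ≤ r / (M ^ 2 + 1) * (M ^ 2 + 1) := by gcongr
    _ = r := div_mul_cancel₀ _ (by positivity)

lemma max_one_rpow_le {ε x y : ℝ} (hε : 0 < ε) (hε1 : ε ≤ 1) (h : y ≤ x) :
    max 1 (ε ^ x) ≤ max 1 (ε ^ y) :=
  max_le_max le_rfl (Real.rpow_le_rpow_of_exponent_ge hε hε1 h)

lemma mul_embeddingConst_mul_le {s : ℝ} (hs : (d : ℝ) / 2 < s) {m N : ℕ} (hm : m ≤ N)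
    {C r : ℝ} {A : ℝ≥0∞} (hA : A ≤ ENNReal.ofReal (C * r)) :
    (m : ℝ≥0∞) * (embeddingConst d s * A) ≤
      ENNReal.ofReal (N * ((embeddingConst d s).toReal * C) * r) := by
  have e : ENNReal.ofReal (N * ((embeddingConst d s).toReal * C) * r) =
      (N : ℝ≥0∞) * (embeddingConst d s * ENNReal.ofReal (C * r)) := by
    rw [mul_assoc, mul_assoc, ENNReal.ofReal_mul (by positivity),
      ENNReal.ofReal_mul ENNReal.toReal_nonneg, ENNReal.ofReal_toReal (embeddingConst_ne_top hs),
      ENNReal.ofReal_natCast]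
  rw [e]
  gcongr

end WavePacket

end

/-! ### The theorem. -/

open WavePacket

theorem proposition4p1 (d n : ℕ) (hn : 1 ≤ n) :
    -- the coefficients of the error terms depend only on `d`, `n` and `ξ`,
    -- and their bound only on `d` and `n`
    ∃ (K : ℝ) (c : WavePacket.Sp d → (Fin d → ℕ) → ℂ),
      (∀ ξ : WavePacket.Sp d, ‖ξ‖ = 1 → ∀ α, ‖c ξ α‖ ≤ K) ∧
      ∀ (p T : ℝ), 0 < p → 0 < T →
      ∀ β : WavePacket.Sp d → ℝ, ContDiff ℝ ∞ β → HasCompactSupport β →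
      -- `G(r) = ∑_{k ≥ 1} g_k r^k / k!` for `0 ≤ r < R`
      ∀ (G : ℝ → ℝ) (R : ℝ) (g : ℕ → ℝ), 0 < R → g 0 = 0 →
      (∀ r : ℝ, 0 ≤ r → r < R → HasSum (fun k : ℕ => g k / (k.factorial : ℝ) * r ^ k) (G r)) →
      ∀ a₀ : 𝓢(WavePacket.Sp d, ℂ),
      ∃ ε₀ : ℝ, 0 < ε₀ ∧
        (∀ ε : ℝ, 0 < ε → ε < ε₀ → ∀ ξ : WavePacket.Sp d, ‖ξ‖ = 1 →
          let a := WavePacket.amplitude n p T β G a₀ ε ξ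
          let v := WavePacket.packet n p T ε ξ a
          -- regularity of the amplitude
          ContDiff ℝ ∞ (fun z : ℝ × WavePacket.Sp d => a z.1 z.2) ∧
          -- (1) the initial condition
          (∀ x : WavePacket.Sp d,
            v (-T) x = ((ε ^ p : ℝ) : ℂ) * a₀ (ε • (x + T • ξ)) *
              Complex.exp (Complex.I * ((inner ℝ x ξ - T / (2 * (n : ℝ)) : ℝ) : ℂ))) ∧
          -- (2) the expansion of the residual
          (∀ (t : ℝ) (x : WavePacket.Sp d),
            WavePacket.residual n β G v t x =
              ((ε ^ (p + 2 * (n : ℝ)) : ℝ) : ℂ) * WavePacket.planeWave n ξ t x *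
                WavePacket.transportTerm n p ε ξ G a (β x)
                  (ε ^ (2 * (n : ℝ)) * (t + T)) (ε • (x + T • ξ))
              + ((ε ^ (p + 2 * (n : ℝ)) : ℝ) : ℂ) * WavePacket.planeWave n ξ t x *
                ∑ j ∈ Finset.Icc 2 (2 * n), ((ε ^ ((j : ℝ) - 2 * (n : ℝ)) : ℝ) : ℂ) *
                  ∑ α ∈ WavePacket.multiIndices d j, c ξ α *
                    WavePacket.mderiv α (a (ε ^ (2 * (n : ℝ)) * (t + T))) (ε • (x + T • ξ))) ∧
          -- the amplitude solves the transport equation with initial value `a₀`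
          (∀ x : WavePacket.Sp d, a 0 x = a₀ x) ∧
          (∀ (t : ℝ) (x : WavePacket.Sp d),
            WavePacket.transportTerm n p ε ξ G a (β (ε⁻¹ • x - T • ξ)) t x = 0) ∧
          -- the spatial derivatives of the amplitude are integrable
          (∀ (t : ℝ) (α : Fin d → ℕ), Integrable (WavePacket.mderiv α (a t)))) ∧
        -- (3) the estimates, uniform in `ε`, `ξ` and `t`
        (∀ σ : ℝ, 0 < σ → ∃ C : ℝ, 0 < C ∧
          ∀ ε : ℝ, 0 < ε → ε < ε₀ → ∀ ξ : WavePacket.Sp d, ‖ξ‖ = 1 → ∀ t : ℝ,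
            let a := WavePacket.amplitude n p T β G a₀ ε ξ
            WavePacket.normFL1 (a t) ≤
              ENNReal.ofReal C * WavePacket.normH ((d : ℝ) / 2 + σ) (a t) ∧
            WavePacket.normH ((d : ℝ) / 2 + σ) (a t) ≤
              ENNReal.ofReal (C * max 1 (ε ^ (2 * p - 2 * (n : ℝ) - σ)))) ∧
        (∀ σ : ℝ, 0 < σ → ∀ j : ℕ, ∃ C : ℝ, 0 < C ∧
          ∀ ε : ℝ, 0 < ε → ε < ε₀ → ∀ ξ : WavePacket.Sp d, ‖ξ‖ = 1 → ∀ t : ℝ,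
            let a := WavePacket.amplitude n p T β G a₀ ε ξ
            (∀ α ∈ WavePacket.multiIndices d j, WavePacket.normFL1 (WavePacket.mderiv α (a t)) ≤
              ENNReal.ofReal (C * max 1 (ε ^ (2 * p - 2 * (n : ℝ) - (j : ℝ) - σ)))) ∧
            WavePacket.normFL1 (WavePacket.Dx j (a t)) ≤
              ENNReal.ofReal (C * max 1 (ε ^ (2 * p - 2 * (n : ℝ) - (j : ℝ) - σ)))) := by
  refine ⟨‖1 / (2 * (n : ℂ))‖ * (1 + 3 * d) ^ n, errorCoeff n,
    fun ξ hξ α => norm_errorCoeff_le n hξ α, ?_⟩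
  intro p T hp _ β hβ hc G R g hR hg0 hG a₀
  obtain ⟨H, hH, hHc, hGH⟩ := exists_smooth_factor hR (by simp [hg0]) hG
  obtain ⟨ε₀, hε₀, hε₀1, hsmall⟩ := exists_threshold hp (by positivity : 0 < R / 4) a₀
  have hprof : ∀ ε, 0 < ε → ε < ε₀ → ∀ ξ : Sp d, ‖ξ‖ = 1 → ∀ t : ℝ,
      amplitude n p T β G a₀ ε ξ t = fun x => profile p T β H a₀ ε ξ
        (ε ^ (-(2 * (n : ℝ))) * t) (x + (ε ^ (1 - 2 * (n : ℝ)) * t) • ξ) :=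
    fun ε hε hlt ξ hξ t =>
      amplitude_eq_profile hβ.continuous hc hGH hε (hsmall ε hε hlt) hξ t
  have hschw : ∀ ε, 0 < ε → ε < ε₀ → ∀ ξ : Sp d, ‖ξ‖ = 1 → ∀ t : ℝ,
      ∃ F : 𝓢(Sp d, ℂ), ⇑F = amplitude n p T β G a₀ ε ξ t := by
    intro ε hε hlt ξ hξ t
    rw [hprof ε hε hlt ξ hξ t]
    exact exists_schwartz_profile hp T hβ hc hH hHc a₀ hε (hlt.le.trans hε₀1) hξ _ _
  have hnormH : ∀ k : ℕ, ∃ C, 0 < C ∧ ∀ ε, 0 < ε → ε < ε₀ → ∀ ξ : Sp d, ‖ξ‖ = 1 → ∀ t : ℝ,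
      normH k (amplitude n p T β G a₀ ε ξ t) ≤
        ENNReal.ofReal (C * max 1 (ε ^ (2 * p - k + ((d : ℝ) - 1) / 2))) := by
    intro k
    obtain ⟨C, hC, hb⟩ := exists_normH_profile_le hp T hβ hc hH hHc a₀ k
    refine ⟨C, hC, fun ε hε hlt ξ hξ t => ?_⟩
    rw [hprof ε hε hlt ξ hξ t]
    exact hb ε hε (hlt.le.trans hε₀1) ξ hξ _ _
  have hn1 : (1 : ℝ) ≤ n := by exact_mod_cast hn
  refine ⟨ε₀, hε₀, ?_, ?_, ?_⟩
  · intro ε hε hlt ξ hξ a v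
    have hinit : ∀ x, a 0 x = a₀ x := fun x => by simp [a, amplitude]
    have ha : ContDiff ℝ ∞ fun z : ℝ × Sp d => a z.1 z.2 :=
      contDiff_amplitude hβ hc hH hGH hε (hsmall ε hε hlt) hξ
    refine ⟨ha, fun x => ?_, fun t x => residual_packet hn hε hξ β G ha t x, hinit,
      fun t x => transportTerm_amplitude hβ hc hH hGH hε (hsmall ε hε hlt) hξ t x,
      fun t α => ?_⟩
    · simp only [v, packet, neg_add_cancel, mul_zero, hinit, planeWave, neg_div, ← sub_eq_add_neg]
    · obtain ⟨F, hF⟩ := hschw ε hε hlt ξ hξ t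
      have := integrable_mderiv F α
      rwa [hF] at this
  · intro σ hσ
    obtain ⟨C, hC, hb⟩ := hnormH ⌈(d : ℝ) / 2 + σ⌉₊
    have hs : (d : ℝ) / 2 < (d : ℝ) / 2 + σ := by linarith
    set e := (embeddingConst d ((d : ℝ) / 2 + σ)).toReal with he
    have he0 : 0 ≤ e := ENNReal.toReal_nonneg
    refine ⟨e + C, by positivity, fun ε hε hlt ξ hξ t => ⟨?_, ?_⟩⟩
    · obtain ⟨F, hF⟩ := hschw ε hε hlt ξ hξ t
      rw [← hF]
      refine (normFL1_le_normH F ((d : ℝ) / 2 + σ)).trans ?_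
      gcongr
      rw [← ENNReal.ofReal_toReal (embeddingConst_ne_top hs)]
      exact ENNReal.ofReal_le_ofReal (by linarith)
    · refine (normH_mono (Nat.le_ceil _) _).trans ((hb ε hε hlt ξ hξ t).trans ?_)
      refine ENNReal.ofReal_le_ofReal ?_
      -- The integer order is below d/2 + σ + 1, so the exponent exceeds 2p - σ - 3/2, and 3/2 ≤ 2n.
      have hk := Nat.ceil_lt_add_one (by positivity : 0 ≤ (d : ℝ) / 2 + σ)
      have hm := max_one_rpow_le hε (hlt.le.trans hε₀1) (x :=
        2 * p - (⌈(d : ℝ) / 2 + σ⌉₊ : ℝ) + ((d : ℝ) - 1) / 2)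
        (y := 2 * p - 2 * (n : ℝ) - σ) (by linarith)
      gcongr
      linarith
  · intro σ hσ j
    -- With natural-number division, d / 2 + 1 is the least integer above half the dimension. It is
    -- at most d/2 + 1 as a real number, so again at most 3/2 is lost.
    obtain ⟨C, hC, hb⟩ := hnormH (d / 2 + 1 + j)
    have hs : (d : ℝ) / 2 < ((d / 2 + 1 : ℕ) : ℝ) := by
      have : (d : ℝ) < ((2 * (d / 2 + 1) : ℕ) : ℝ) := by exact_mod_cast (by omega)
      push_cast at this ⊢
      linarith
    have hd : ((d / 2 + 1 : ℕ) : ℝ) ≤ (d : ℝ) / 2 + 1 := by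
      push_cast
      gcongr
      exact Nat.cast_div_le
    set e := (embeddingConst d ((d / 2 + 1 : ℕ) : ℝ)).toReal with he
    have he0 : 0 ≤ e := ENNReal.toReal_nonneg
    -- Covers a single derivative (factor 1) and the sum over all of them (factor the cardinality),
    -- even when there are none.
    set N := (multiIndices d j).card + 1 with hN
    have hbound : ∀ ε, 0 < ε → ε < ε₀ → ∀ ξ : Sp d, ‖ξ‖ = 1 → ∀ t : ℝ,
        normH (((d / 2 + 1 : ℕ) : ℝ) + j) (amplitude n p T β G a₀ ε ξ t) ≤
          ENNReal.ofReal (C * max 1 (ε ^ (2 * p - 2 * (n : ℝ) - (j : ℝ) - σ))) := by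
      intro ε hε hlt ξ hξ t
      rw [← Nat.cast_add]
      refine (hb ε hε hlt ξ hξ t).trans (ENNReal.ofReal_le_ofReal ?_)
      gcongr ?_ * ?_
      refine max_one_rpow_le hε (hlt.le.trans hε₀1) ?_
      rw [Nat.cast_add]
      linarith
    have hle : ∀ r : ℝ, 0 ≤ r → ENNReal.ofReal (N * (e * C) * r) ≤
        ENNReal.ofReal ((N * (e * C) + 1) * r) :=
      fun r hr => ENNReal.ofReal_le_ofReal (by gcongr; linarith)
    refine ⟨N * (e * C) + 1, by positivity, fun ε hε hlt ξ hξ t => ?_⟩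
    obtain ⟨F, hF⟩ := hschw ε hε hlt ξ hξ t
    have hB := hbound ε hε hlt ξ hξ t
    have hr : 0 ≤ max 1 (ε ^ (2 * p - 2 * (n : ℝ) - (j : ℝ) - σ)) := by positivity
    dsimp only
    rw [← hF] at hB ⊢
    refine ⟨fun α hα => ?_, ?_⟩
    · refine (normFL1_mderiv_le F ((d / 2 + 1 : ℕ) : ℝ) hα).trans (le_trans ?_ (hle _ hr))
      have := mul_embeddingConst_mul_le hs (m := 1) (N := N) (by omega) hB
      rwa [Nat.cast_one, one_mul] at this
    · refine (normFL1_Dx_le F ((d / 2 + 1 : ℕ) : ℝ) j).trans (le_trans ?_ (hle _ hr))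
      exact mul_embeddingConst_mul_le hs (by omega) hB
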